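/- Let $k$ be a field of characteristic zero, let $G$ be a finite simple graph with vertices $v_1,\dots,v_n$, and let $R=k[x_1,\dots,x_n]$. Let $F_G=\prod_{i<j,\ \{v_i,v_j\}\in E(G)}(x_i-x_j)$ be the polynomial defining the graphic arrangement $\mathcal A_G$, and let $J_G=\langle \partial F_G/\partial x_1,\dots,\partial F_G/\partial x_n\rangle$ be its Jacobian ideal. Let $\overline{J}_G$ be the top-dimensional part of $J_G$, i.e. the intersection of the primary ideals whose associated prime has height two in a minimal primary decomposition of $J_G$ (with $\overline J_G=R$ if there are none). Assume that no two distinct 3-cycles of $G$ share an edge. Then the rings $R/\sqrt{J_G}$ and $R/\overline{J}_G$ are both Cohen–Macaulay (where the zero ring is counted as Cohen–Macaulay). -/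

import Mathlib

noncomputable section

namespace GraphicCM

/-- The depth of a local ring: the supremum of the lengths of the regular sequences contained in
its maximal ideal. -/
def localDepth (A : Type*) [CommRing A] [IsLocalRing A] : ℕ∞ :=
  ⨆ rs : {rs : List A // (∀ r ∈ rs, r ∈ IsLocalRing.maximalIdeal A) ∧
    RingTheory.Sequence.IsRegular A rs}, (rs.1.length : ℕ∞)

/-- A commutative ring is Cohen–Macaulay if it is Noetherian and its localization at every prime
ideal has depth equal to its Krull dimension. (The zero ring satisfies this, by convention.) -/
structure IsCohenMacaulay (A : Type*) [CommRing A] : Prop where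
  noetherian : IsNoetherianRing A
  depth_eq_dim : ∀ (p : Ideal A) [p.IsPrime],
    ((localDepth (Localization.AtPrime p) : ℕ∞) : WithBot ℕ∞) =
      ringKrullDim (Localization.AtPrime p)

open Classical in
/-- The product of the linear forms `x_i - x_j`, one for every edge `{i, j}` of `G` (with `i < j`),
which defines the graphic arrangement of `G`. -/
def graphicPolynomial (k : Type*) [Field k] {n : ℕ} (G : SimpleGraph (Fin n)) :
    MvPolynomial (Fin n) k :=
  ∏ e : Fin n × Fin n with e.1 < e.2 ∧ G.Adj e.1 e.2, (MvPolynomial.X e.1 - MvPolynomial.X e.2)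

/-- The Jacobian ideal of a polynomial: the ideal generated by its first partial derivatives. -/
def jacobianIdeal {k : Type*} [Field k] {n : ℕ} (F : MvPolynomial (Fin n) k) :
    Ideal (MvPolynomial (Fin n) k) :=
  Ideal.span (Set.range fun i => MvPolynomial.pderiv i F)

/-- `K` is a top-dimensional part of `J`: the intersection of those primary ideals in
a (minimal) primary decomposition of `J` whose associated prime has height two. -/
def IsHeightTwoPart {A : Type*} [CommRing A] (J K : Ideal A) : Prop :=
  ∃ t : Finset (Ideal A), Submodule.IsMinimalPrimaryDecomposition J t ∧
    K = ⨅ q ∈ {q : Ideal A | q ∈ t ∧ q.radical.height = 2}, q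

/-- Over a Noetherian ring such an ideal exists. -/
theorem exists_isHeightTwoPart {A : Type*} [CommRing A] [IsNoetherianRing A] (J : Ideal A) :
    ∃ K : Ideal A, IsHeightTwoPart J K := by
  obtain ⟨t, ht⟩ := Submodule.IsLasker.exists_isMinimalPrimaryDecomposition (Submodule.isLasker A A) J
  exact ⟨_, t, ht, rfl⟩

end GraphicCM

end

/-! Group the edges of `G` into classes: the three edges of a 3-cycle, or a single edge lying in no
3-cycle. Edge-disjointness makes this a partition, so `F` is a product of coprime factors `F_c`. Let
`J_c` be the Jacobian ideal of `F_c`. It is the unit ideal for a single edge; for a triangle with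
forms `a`, `b`, `a + b` it is the complete intersection `(b(2a + b), a(a + 2b))`, with radical `(a,
b)`. Let `D` be generated by `F` and all `(F / F_c) J_c`, and let `D'` be the same with `J_c`
replaced by its radical (`liaisonSum`).

If `G` has an edge, every prime over the Jacobian ideal `J` contains a flat prime, generated by two
edge forms. These primes all have height two. The Leibniz rule gives `J ≤ D ≤ D'`. Localized at a
flat, `J` agrees with `D`, and the radical of `J` with `D'`.

Both `D` and `D'` are `Assembled`: their quotients are iterated extensions of quotients by flat
primes, through the colon ideals of `Assembled.liaison`. Such an ideal is determined by its
localizations at the flats (`Assembled.mem_of_forall`), so `D` is the height two part of `J` and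
`D'` is its radical.

For Cohen–Macaulayness, `exists_generic_coordinates` finds one polynomial subring `A` mapping
isomorphically onto `R/P` for all flat primes `P` at once. The extensions then split over `A`, so
`R/D` and `R/D'` are finite projective over a polynomial ring, and regular sequences of full length
pull up along finite flat maps. -/

namespace GraphicCM

section CohenMacaulay

open RingTheory.Sequence IsLocalRing Polynomial

/-! ### Regular sequences of maximal length -/

/-- A ring has a full regular sequence if it has a regular sequence whose length is at least
its Krull dimension. -/
def HasFullRegularSequence (A : Type*) [CommRing A] : Prop :=
  ∃ rs : List A, IsRegular A rs ∧ ringKrullDim A ≤ rs.length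

theorem mem_maximalIdeal_of_isRegular {A : Type*} [CommRing A] [IsLocalRing A] {rs : List A}
    (h : IsRegular A rs) : ∀ r ∈ rs, r ∈ maximalIdeal A := by
  intro r hr
  by_contra hu
  have hu' : IsUnit r := by simpa using hu
  apply h.2
  have : Ideal.ofList rs = ⊤ := Ideal.eq_top_of_isUnit_mem _ (Ideal.subset_span hr) hu'
  simp [this]

/-- A regular sequence lowers the dimension by its length, and the nonzero quotient has dimension at
least zero; so no regular sequence is longer than the dimension. -/
theorem localDepth_eq_ringKrullDim {A : Type*} [CommRing A] [IsLocalRing A] [IsNoetherianRing A]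
    (h : HasFullRegularSequence A) :
    ((localDepth A : ℕ∞) : WithBot ℕ∞) = ringKrullDim A := by
  apply le_antisymm
  · obtain ⟨d, hd⟩ : ∃ d : ℕ∞, ringKrullDim A = d :=
      ⟨_, (maximalIdeal_height_eq_ringKrullDim (R := A)).symm⟩
    rw [hd, WithBot.coe_le_coe]
    refine iSup_le fun ⟨rs, _, hrs⟩ => ?_
    have h1 := ringKrullDim_add_length_eq_ringKrullDim_of_isRegular rs hrs
    have h2 : Nontrivial (A ⧸ Ideal.ofList rs) := by
      rw [Ideal.Quotient.nontrivial_iff]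
      intro h
      exact hrs.2 (by simp [h])
    have h3 : (0 : WithBot ℕ∞) ≤ ringKrullDim (A ⧸ Ideal.ofList rs) :=
      ringKrullDim_nonneg_of_nontrivial
    rw [← WithBot.coe_le_coe, ← hd, ← h1]
    simpa using add_le_add_left h3 (rs.length : WithBot ℕ∞)
  · obtain ⟨rs, hrs, hd⟩ := h
    refine hd.trans ?_
    have : ((rs.length : ℕ∞)) ≤ localDepth A :=
      le_iSup (fun rs : {rs : List A // (∀ r ∈ rs, r ∈ maximalIdeal A) ∧ IsRegular A rs} =>
        (rs.1.length : ℕ∞)) ⟨rs, mem_maximalIdeal_of_isRegular hrs, hrs⟩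
    exact_mod_cast WithBot.coe_le_coe.mpr this

theorem HasFullRegularSequence.of_ringEquiv {A B : Type*} [CommRing A] [CommRing B] (e : A ≃+* B)
    (h : HasFullRegularSequence A) : HasFullRegularSequence B := by
  obtain ⟨rs, hrs, hd⟩ := h
  refine ⟨rs.map e, ?_, ?_⟩
  · exact (AddEquiv.isRegular_congr (e := e.toAddEquiv) <| List.forall₂_map_right_iff.mpr <|
      List.forall₂_same.mpr fun r _ x => e.map_mul r x).1 hrs
  · rw [← ringKrullDim_eq_of_ringEquiv e]
    simpa using hd

/-- All local rings of the ring have a full regular sequence. -/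
def LocallyFullRegularSequence (A : Type*) [CommRing A] : Prop :=
  ∀ (p : Ideal A) [p.IsPrime], HasFullRegularSequence (Localization.AtPrime p)

theorem LocallyFullRegularSequence.isCohenMacaulay {A : Type*} [CommRing A] [IsNoetherianRing A]
    (h : LocallyFullRegularSequence A) : IsCohenMacaulay A :=
  ⟨‹_›, fun p _ =>
    have : IsNoetherianRing (Localization.AtPrime p) :=
      IsLocalization.isNoetherianRing p.primeCompl _ ‹_›
    localDepth_eq_ringKrullDim (h p)⟩

theorem LocallyFullRegularSequence.of_ringEquiv {A B : Type*} [CommRing A] [CommRing B]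
    (e : A ≃+* B) (h : LocallyFullRegularSequence A) : LocallyFullRegularSequence B := by
  intro p hp
  exact (h (p.comap e)).of_ringEquiv <| IsLocalization.ringEquivOfRingEquiv
    (Localization.AtPrime (p.comap e)) (Localization.AtPrime p) e (e.map_primeCompl_comap_eq p)

theorem LocallyFullRegularSequence.of_field (k : Type*) [Field k] :
    LocallyFullRegularSequence k := by
  intro p hp
  refine ⟨[], IsRegular.nil _ _, ?_⟩
  rw [IsLocalization.AtPrime.ringKrullDim_eq_height p]
  simpa using Ideal.height_le_ringKrullDim_of_ne_top (I := p) hp.ne_top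

/-- A monic polynomial is a nonzerodivisor modulo an ideal extended from the coefficients. -/
theorem isSMulRegular_quotient_map_C {R : Type*} [CommRing R] (I : Ideal R) {f : R[X]}
    (hf : f.Monic) {J : Ideal R[X]} (hJ : J = I.map C) : IsSMulRegular (R[X] ⧸ J) f := by
  subst hJ
  rw [isSMulRegular_iff_right_eq_zero_of_smul]
  intro x hx
  obtain ⟨g, rfl⟩ := Ideal.Quotient.mk_surjective x
  have hx' : f * g ∈ I.map C := by
    rw [← Ideal.Quotient.eq_zero_iff_mem]
    exact hx
  rw [Ideal.Quotient.eq_zero_iff_mem]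
  rw [← Ideal.mk_ker (I := I), ← Polynomial.ker_mapRingHom, RingHom.mem_ker] at hx' ⊢
  rw [map_mul] at hx'
  simp only [coe_mapRingHom] at hx' ⊢
  exact (hf.map (Ideal.Quotient.mk I)).mul_right_eq_zero_iff.mp hx'

theorem HasFullRegularSequence.localization_polynomial {R : Type*} [CommRing R] [IsLocalRing R]
    [IsNoetherianRing R] (h : HasFullRegularSequence R) (p : Ideal R[X]) [p.IsPrime]
    (hp : p.comap C = maximalIdeal R) : HasFullRegularSequence (Localization.AtPrime p) := by
  obtain ⟨rs, hrs, hd⟩ := h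
  have hmem := mem_maximalIdeal_of_isRegular hrs
  have hreg : IsWeaklyRegular R[X] (rs.map C) := hrs.1.of_flat
  have hmem' : ∀ r ∈ rs.map C, r ∈ p := by
    intro r hr
    obtain ⟨s, hs, rfl⟩ := List.mem_map.mp hr
    have : s ∈ p.comap C := hp ▸ hmem s hs
    exact this
  -- If `p` is extended, its height is that of the maximal ideal of `R` and the old sequence
  -- suffices. Otherwise `p` needs one further generator, a monic polynomial, which prolongs the
  -- sequence while the dimension grows by at most one.
  by_cases eq : p = (p.comap C).map C
  · refine ⟨_, hreg.isRegular_of_isLocalization_of_mem _ p hmem', ?_⟩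
    have hht : p.height = (maximalIdeal R).height := by
      rw [congrArg Ideal.height eq, hp, height_map_C]
    rw [IsLocalization.AtPrime.ringKrullDim_eq_height p, hht, maximalIdeal_height_eq_ringKrullDim]
    simpa using hd
  · have : (p.comap C).IsMaximal := hp ▸ maximalIdeal.isMaximal R
    obtain ⟨y, hy, hpy⟩ := Polynomial.exists_monic_span_sup_map_eq R p this eq
    have hreg2 : IsWeaklyRegular R[X] (rs.map C ++ [y]) := by
      rw [isWeaklyRegular_append_iff]
      refine ⟨hreg, (isWeaklyRegular_singleton_iff _ _).2 ?_⟩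
      exact isSMulRegular_quotient_map_C (Ideal.ofList rs) hy (by simp [Ideal.map_ofList])
    have hmem2 : ∀ r ∈ rs.map C ++ [y], r ∈ p := by
      intro r hr
      rcases List.mem_append.mp hr with hr | hr
      · exact hmem' r hr
      · rw [List.mem_singleton.mp hr, hpy]
        exact Ideal.mem_sup_right (Ideal.mem_span_singleton_self y)
    refine ⟨_, hreg2.isRegular_of_isLocalization_of_mem _ p hmem2, ?_⟩
    rw [IsLocalization.AtPrime.ringKrullDim_eq_height p]
    refine (Ideal.height_le_ringKrullDim_of_ne_top (I := p) Ideal.IsPrime.ne_top').trans ?_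
    rw [Polynomial.ringKrullDim_of_isNoetherianRing]
    simpa using add_le_add_left hd 1

/-- Localizing the coefficients at the contraction `q` of `p` first does not change the local ring
at `p`, and reduces to a prime lying over the maximal ideal of a local ring. -/
theorem LocallyFullRegularSequence.polynomial {R : Type*} [CommRing R] [IsNoetherianRing R]
    (h : LocallyFullRegularSequence R) : LocallyFullRegularSequence R[X] := by
  intro p hp
  let q := p.comap C
  let S := (Localization.AtPrime q)[X]
  let pc := Submonoid.map Polynomial.C.toMonoidHom q.primeCompl
  let : Algebra R[X] S := algebra R (Localization.AtPrime q)
  have : IsLocalization pc S := Polynomial.isLocalization _ _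
  let pS := p.map (algebraMap R[X] S)
  have disj : Disjoint (pc : Set R[X]) (p : Set R[X]) := by
    simpa [pc, q] using! Set.disjoint_image_left.mpr
      (Set.disjoint_compl_left_iff_subset.mpr (fun _ a ↦ a))
  have : pS.IsPrime := IsLocalization.isPrime_of_isPrime_disjoint pc _ _ ‹_› disj
  have : IsLocalization.AtPrime (Localization.AtPrime pS) p := by
    convert IsLocalization.isLocalization_isLocalization_atPrime_isLocalization pc
      (Localization.AtPrime pS) pS
    exact (IsLocalization.under_map_of_isPrime_disjoint pc _ ‹_› disj).symm
  have : IsNoetherianRing (Localization.AtPrime q) :=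
    IsLocalization.isNoetherianRing q.primeCompl _ ‹_›
  have eq : Ideal.comap C pS = maximalIdeal (Localization.AtPrime q) := by
    rw [← IsLocalization.map_under q.primeCompl _ (Ideal.comap C pS),
      ← IsLocalization.map_under q.primeCompl _ (maximalIdeal (Localization.AtPrime q))]
    simp only [Ideal.comap_comap, S, pS]
    rw [← Polynomial.algebraMap_eq (R := Localization.AtPrime q),
      ← IsScalarTower.algebraMap_eq R (Localization.AtPrime q) (Localization.AtPrime q)[X],
      IsScalarTower.algebraMap_eq R R[X] (Localization.AtPrime q)[X], ← Ideal.comap_comap,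
      ← Ideal.under_def R[X], IsLocalization.under_map_of_isPrime_disjoint pc _ ‹_› disj]
    simp [q, IsLocalization.AtPrime.under_maximalIdeal (Localization.AtPrime q) q]
  exact ((h q).localization_polynomial pS eq).of_ringEquiv (IsLocalization.algEquiv p.primeCompl
    (Localization.AtPrime pS) (Localization.AtPrime p)).toRingEquiv

theorem LocallyFullRegularSequence.mvPolynomial (k : Type*) [Field k] (ι : Type*) [Finite ι] :
    LocallyFullRegularSequence (MvPolynomial ι k) := by
  induction ι using Finite.induction_empty_option with
  | of_equiv e H => exact H.of_ringEquiv (MvPolynomial.renameEquiv _ e).toRingEquiv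
  | h_empty => exact (of_field k).of_ringEquiv (MvPolynomial.isEmptyRingEquiv k _).symm
  | h_option IH =>
    exact IH.polynomial.of_ringEquiv (MvPolynomial.optionEquivLeft _ _).toRingEquiv.symm

/-- Incomparability: contraction along an integral extension is strictly monotone on primes, so it
preserves the length of chains. -/
theorem height_le_height_under_of_isIntegral {A B : Type*} [CommRing A] [CommRing B] [Algebra A B]
    [Algebra.IsIntegral A B] (p : Ideal B) [hp : p.IsPrime] :
    p.height ≤ (p.under A).height := by
  have hmono : StrictMono (PrimeSpectrum.comap (algebraMap A B)) := fun I J hIJ =>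
    Ideal.IsIntegral.comap_lt_comap (I := I.asIdeal) (J := J.asIdeal) hIJ
  have := Order.height_le_height_apply_of_strictMono _ hmono ⟨p, hp⟩
  rw [← PrimeSpectrum.height_eq_orderHeight, ← PrimeSpectrum.height_eq_orderHeight] at this
  exact this

/-- A finite flat algebra inherits full regular sequences. -/
theorem LocallyFullRegularSequence.of_finite_flat {A B : Type*} [CommRing A] [CommRing B]
    [Algebra A B] [Module.Finite A B] [Module.Flat A B] (h : LocallyFullRegularSequence A) :
    LocallyFullRegularSequence B := by
  intro p hp
  obtain ⟨rs, hrs, hd⟩ := h (p.under A)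
  have hle := height_le_height_under_of_isIntegral (A := A) p
  rw [IsLocalization.AtPrime.ringKrullDim_eq_height (p.under A)] at hd
  have hflat : (algebraMap A B).Flat := RingHom.flat_algebraMap_iff.mpr ‹_›
  let φ := Localization.localRingHom (p.under A) p (algebraMap A B) rfl
  have hφ : φ.Flat := hflat.localRingHom p (p.under A) rfl
  have hloc : IsLocalHom φ := Localization.isLocalHom_localRingHom _ _ _ _
  let := φ.toAlgebra
  have : Module.Flat (Localization.AtPrime (p.under A)) (Localization.AtPrime p) := hφ
  have : IsLocalHom (algebraMap (Localization.AtPrime (p.under A)) (Localization.AtPrime p)) := hloc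
  have := Module.FaithfullyFlat.of_flat_of_isLocalHom
    (A := Localization.AtPrime (p.under A)) (B := Localization.AtPrime p)
  -- A flat local homomorphism is faithfully flat, so the sequence stays regular; integrality keeps
  -- the dimension from growing.
  refine ⟨_, hrs.of_faithfullyFlat (S := Localization.AtPrime p), ?_⟩
  rw [IsLocalization.AtPrime.ringKrullDim_eq_height p]
  refine (WithBot.coe_le_coe.mpr hle).trans ?_
  simpa using hd

/-- A ring which is a finite flat algebra over a polynomial ring over a field is
Cohen–Macaulay. -/
theorem isCohenMacaulay_of_finite_flat (k : Type*) [Field k] (ι : Type*) [Finite ι] (B : Type*)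
    [CommRing B] [Algebra (MvPolynomial ι k) B] [Module.Finite (MvPolynomial ι k) B]
    [Module.Flat (MvPolynomial ι k) B] : IsCohenMacaulay B :=
  have : IsNoetherianRing B := IsNoetherianRing.of_finite (MvPolynomial ι k) B
  ((LocallyFullRegularSequence.mvPolynomial k ι).of_finite_flat (B := B)).isCohenMacaulay

end CohenMacaulay

/-! ### Ideals assembled from a family of primes by extensions -/

section Assembled

variable {R : Type*} [CommRing R]

/-- The ideals whose quotient is an iterated extension of quotients by members of `Ps`. -/
inductive Assembled (Ps : Set (Ideal R)) : Ideal R → Prop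
  | top : Assembled Ps ⊤
  | of_mem {P : Ideal R} : P ∈ Ps → Assembled Ps P
  | extend {I I' : Ideal R} (g : R) : (∀ x, g * x ∈ I ↔ x ∈ I') → Assembled Ps I' →
      Assembled Ps (I ⊔ Ideal.span {g}) → Assembled Ps I

variable {Ps : Set (Ideal R)}

/-- An ideal assembled from `Ps` is the intersection of its localizations at the members
of `Ps`. -/
theorem Assembled.mem_of_forall (hPs : ∀ P ∈ Ps, P.IsPrime) {I : Ideal R} (h : Assembled Ps I) :
    ∀ {x : R}, (∀ P ∈ Ps, ∃ s ∉ P, s * x ∈ I) → x ∈ I := by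
  induction h with
  | top => simp
  | @of_mem Q hQ =>
    intro x hx
    obtain ⟨s, hs, hsx⟩ := hx Q hQ
    exact ((hPs Q hQ).mem_or_mem hsx).resolve_left hs
  | @extend I I' g hg _ _ ih' ih =>
    intro x hx
    have hx1 : x ∈ I ⊔ Ideal.span {g} := ih fun P hP => by
      obtain ⟨s, hs, hsx⟩ := hx P hP
      exact ⟨s, hs, Ideal.mem_sup_left hsx⟩
    obtain ⟨i, hi, z, hz, rfl⟩ := Submodule.mem_sup.mp hx1
    obtain ⟨y, rfl⟩ := Ideal.mem_span_singleton'.mp hz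
    refine I.add_mem hi ?_
    rw [mul_comm, hg]
    refine ih' fun P hP => ?_
    obtain ⟨s, hs, hsx⟩ := hx P hP
    refine ⟨s, hs, (hg _).1 ?_⟩
    have := I.sub_mem hsx (I.mul_mem_left s hi)
    convert this using 1
    ring

theorem finite_projective_of_exact {A M N P : Type*} [CommRing A] [AddCommGroup M] [Module A M]
    [AddCommGroup N] [Module A N] [AddCommGroup P] [Module A P] {f : M →ₗ[A] N} {g : N →ₗ[A] P}
    (hfg : Function.Exact f g) (hf : Function.Injective f) (hg : Function.Surjective g)
    (hM : Module.Finite A M ∧ Module.Projective A M)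
    (hP : Module.Finite A P ∧ Module.Projective A P) :
    Module.Finite A N ∧ Module.Projective A N := by
  obtain ⟨_, _⟩ := hM
  obtain ⟨_, _⟩ := hP
  obtain ⟨s, hs⟩ := Module.projective_lifting_property g LinearMap.id hg
  let e := (hfg.splitSurjectiveEquiv hf ⟨s, hs⟩).1
  exact ⟨Module.Finite.equiv e.symm, Module.Projective.of_equiv e.symm⟩

/-- As `I'` is the colon ideal `I : g`, multiplication by `g` gives an exact sequence `0 → R/I' →
R/I → R/(I + (g)) → 0`, which splits over `A` once the right end is projective. -/
theorem Assembled.finite_projective {A : Type*} [CommRing A] [Algebra A R]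
    (hPs : ∀ P ∈ Ps, Module.Finite A (R ⧸ P) ∧ Module.Projective A (R ⧸ P)) {I : Ideal R}
    (h : Assembled Ps I) : Module.Finite A (R ⧸ I) ∧ Module.Projective A (R ⧸ I) := by
  induction h with
  | top =>
    have : Subsingleton (R ⧸ (⊤ : Ideal R)) := Ideal.Quotient.subsingleton_iff.mpr rfl
    exact ⟨inferInstance, inferInstance⟩
  | of_mem hQ => exact hPs _ hQ
  | @extend I I' g hg _ _ ih' ih =>
    let f : (R ⧸ I') →ₗ[A] (R ⧸ I) :=
      (Submodule.mapQ I' I (LinearMap.mulLeft R g) fun x hx => (hg x).2 hx).restrictScalars A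
    let q : (R ⧸ I) →ₗ[A] (R ⧸ (I ⊔ Ideal.span {g})) :=
      (Submodule.factor (le_sup_left : I ≤ I ⊔ Ideal.span {g})).restrictScalars A
    refine finite_projective_of_exact (f := f) (g := q) ?_ ?_ ?_ ih' ih
    · intro y
      obtain ⟨y, rfl⟩ := Ideal.Quotient.mk_surjective y
      constructor
      · intro hy
        have hy' : y ∈ I ⊔ Ideal.span {g} := Ideal.Quotient.eq_zero_iff_mem.mp hy
        obtain ⟨i, hi, z, hz, rfl⟩ := Submodule.mem_sup.mp hy'
        obtain ⟨y, rfl⟩ := Ideal.mem_span_singleton'.mp hz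
        refine ⟨Ideal.Quotient.mk _ y, ?_⟩
        refine Ideal.Quotient.eq.mpr (?_ : g * y - (i + y * g) ∈ I)
        convert I.neg_mem hi using 1
        ring
      · rintro ⟨z, hz⟩
        obtain ⟨z, rfl⟩ := Ideal.Quotient.mk_surjective z
        rw [← hz]
        exact Ideal.Quotient.eq_zero_iff_mem.mpr (Ideal.mem_sup_right
          (Ideal.mul_mem_right _ _ (Ideal.mem_span_singleton_self g)) : g * z ∈ _)
    · rw [injective_iff_map_eq_zero]
      intro z hz
      obtain ⟨z, rfl⟩ := Ideal.Quotient.mk_surjective z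
      exact Ideal.Quotient.eq_zero_iff_mem.mpr ((hg z).1 (Ideal.Quotient.eq_zero_iff_mem.mp hz))
    · intro y
      obtain ⟨y, rfl⟩ := Ideal.Quotient.mk_surjective y
      exact ⟨Ideal.Quotient.mk _ y, rfl⟩

/-! ### Complete intersections and liaison -/

section Pairs

variable [IsDomain R] [DecompositionMonoid R]

/-- Coprimality gives `(f, gh) : g = (f, h)`, while adding `g` to `(f, gh)` gives `(f, g)`. -/
theorem Assembled.span_pair_mul {f g h : R} (hfg : IsRelPrime f g)
    (h1 : Assembled Ps (Ideal.span {f, g})) (h2 : Assembled Ps (Ideal.span {f, h})) :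
    Assembled Ps (Ideal.span {f, g * h}) := by
  rcases eq_or_ne g 0 with rfl | hg0
  · simpa using h1
  refine .extend (I' := Ideal.span {f, h}) g (fun x => ?_) h2 ?_
  · simp only [Ideal.mem_span_pair]
    constructor
    · rintro ⟨u, v, huv⟩
      have hgu : g ∣ u := by
        refine hfg.symm.dvd_of_dvd_mul_right (z := f) ?_
        exact ⟨x - v * h, by linear_combination huv⟩
      obtain ⟨u, rfl⟩ := hgu
      exact ⟨u, v, mul_left_cancel₀ hg0 (by linear_combination huv)⟩
    · rintro ⟨u, v, rfl⟩
      exact ⟨g * u, v, by ring⟩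
  · convert h1 using 1
    apply le_antisymm
    · rw [sup_le_iff, Ideal.span_singleton_le_iff_mem, Ideal.span_le]
      refine ⟨?_, Ideal.subset_span (by simp)⟩
      rintro x (rfl | rfl)
      · exact Ideal.subset_span (by simp)
      · exact Ideal.mul_mem_right _ _ (Ideal.subset_span (by simp))
    · rw [Ideal.span_le]
      rintro x (rfl | rfl)
      · exact Ideal.mem_sup_left (Ideal.subset_span (by simp))
      · exact Ideal.mem_sup_right (Ideal.mem_span_singleton_self _)

theorem Assembled.span_pair_prod {ι : Type*} {f : R} (t : Finset ι) (m : ι → R)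
    (hrel : ∀ j ∈ t, IsRelPrime f (m j)) (h : ∀ j ∈ t, Assembled Ps (Ideal.span {f, m j})) :
    Assembled Ps (Ideal.span {f, ∏ j ∈ t, m j}) := by
  classical
  induction t using Finset.induction_on with
  | empty => 
    convert Assembled.top
    rw [Ideal.eq_top_iff_one]
    exact Ideal.subset_span (by simp)
  | insert j t hj ih =>
    rw [Finset.prod_insert hj]
    exact span_pair_mul (hrel j (by simp)) (h j (by simp))
      (ih (fun i hi => hrel i (by simp [hi])) fun i hi => h i (by simp [hi]))

theorem Assembled.span_prod_prod {ι κ : Type*} (s : Finset ι) (t : Finset κ) (l : ι → R) (m : κ → R)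
    (hrel : ∀ i ∈ s, ∀ j ∈ t, IsRelPrime (l i) (m j))
    (h : ∀ i ∈ s, ∀ j ∈ t, Assembled Ps (Ideal.span {l i, m j})) :
    Assembled Ps (Ideal.span {∏ i ∈ s, l i, ∏ j ∈ t, m j}) := by
  refine span_pair_prod t m (fun j hj => IsRelPrime.prod_left fun i hi => hrel i hi j hj)
    fun j hj => ?_
  rw [Ideal.span_pair_comm]
  refine span_pair_prod s l (fun i hi => (hrel i hi j hj).symm) fun i hi => ?_
  rw [Ideal.span_pair_comm]
  exact h i hi j hj

/-- The ideal generated by the two partial derivatives of `a * b * (a + b)`. -/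
theorem Assembled.span_triangle {a b : R} (h3 : IsUnit (3 : R)) (hab : IsRelPrime a b)
    (h : Assembled Ps (Ideal.span {a, b})) :
    Assembled Ps (Ideal.span {b * (2 * a + b), a * (a + 2 * b)}) := by
  obtain ⟨c, hc⟩ := h3.exists_left_inv
  have hba : Assembled Ps (Ideal.span {b, a}) := by rwa [Ideal.span_pair_comm]
  have e1 : Ideal.span {b, a + 2 * b} = Ideal.span {b, a} :=
    Ideal.span_pair_add_mul_left _ _ _
  have e2 : Ideal.span {a, 2 * a + b} = Ideal.span {a, b} :=
    Ideal.span_pair_mul_left_add _ _ _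
  -- The change of basis has determinant `3`. Each factor of one generator, paired with each factor
  -- of the other, thus spans the same ideal `(a, b)`.
  have e3 : Ideal.span {2 * a + b, a + 2 * b} = Ideal.span {a, b} := by
    apply le_antisymm <;> rw [Ideal.span_le] <;> rintro x (rfl | rfl) <;>
      rw [SetLike.mem_coe, Ideal.mem_span_pair]
    · exact ⟨2, 1, by ring⟩
    · exact ⟨1, 2, by ring⟩
    · exact ⟨2 * c, -c, by linear_combination x * hc⟩
    · exact ⟨-c, 2 * c, by linear_combination x * hc⟩
  have r1 : IsRelPrime b (a + 2 * b) := by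
    intro d h1 h2
    exact hab ((dvd_add_left (h1.mul_left 2)).1 h2) h1
  have r2 : IsRelPrime a (2 * a + b) := by
    intro d h1 h2
    exact hab h1 ((dvd_add_right (h1.mul_left 2)).1 h2)
  have r3 : IsRelPrime (2 * a + b) (a + 2 * b) := by
    intro d h1 h2
    refine hab ?_ ?_
    · convert dvd_sub (h1.mul_left (2 * c)) (h2.mul_left c) using 1
      linear_combination -a * hc
    · convert dvd_sub (h2.mul_left (2 * c)) (h1.mul_left c) using 1
      linear_combination -b * hc
  have k1 : Assembled Ps (Ideal.span {b, a * (a + 2 * b)}) :=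
    span_pair_mul hab.symm hba (e1 ▸ hba)
  have k2 : Assembled Ps (Ideal.span {2 * a + b, a * (a + 2 * b)}) :=
    span_pair_mul r2.symm (by rwa [Ideal.span_pair_comm, e2]) (by rwa [e3])
  rw [Ideal.span_pair_comm] at k1 k2 ⊢
  exact span_pair_mul (IsRelPrime.mul_left hab r1.symm) k1 k2

/-- Two extensions suffice. The colon of `f' I + f I'` by `f` is `I'`; adding `f` leaves `f' I +
(f)`, whose colon by `f'` is `I`; adding `f'` leaves `(f, f')`. Coprimality of `f` and `f'` computes
both colons. -/
theorem Assembled.liaison {I I' : Ideal R} {f f' : R} (hf : f ∈ I) (hf' : f' ∈ I')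
    (hrel : IsRelPrime f f') (hI : Assembled Ps I) (hI' : Assembled Ps I')
    (hff' : Assembled Ps (Ideal.span {f, f'})) :
    Assembled Ps (Ideal.span {f'} * I ⊔ Ideal.span {f} * I') := by
  rcases eq_or_ne f 0 with rfl | hf0
  · have : Ideal.span {f'} = ⊤ := Ideal.eq_top_of_isUnit_mem _
      (Ideal.mem_span_singleton_self f') (isRelPrime_zero_left.mp hrel)
    simpa [this] using hI
  rcases eq_or_ne f' 0 with rfl | hf0'
  · have : Ideal.span {f} = ⊤ := Ideal.eq_top_of_isUnit_mem _
      (Ideal.mem_span_singleton_self f) (isRelPrime_zero_right.mp hrel)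
    simpa [this] using hI'
  have key : ∀ x, x ∈ Ideal.span {f'} * I ⊔ Ideal.span {f} * I' ↔
      ∃ y ∈ I, ∃ z ∈ I', x = f' * y + f * z := by
    intro x
    simp only [Submodule.mem_sup, Ideal.mem_span_singleton_mul]
    constructor
    · rintro ⟨_, ⟨y, hy, rfl⟩, _, ⟨z, hz, rfl⟩, rfl⟩
      exact ⟨y, hy, z, hz, rfl⟩
    · rintro ⟨y, hy, z, hz, rfl⟩
      exact ⟨_, ⟨y, hy, rfl⟩, _, ⟨z, hz, rfl⟩, rfl⟩
  have key2 : ∀ x, x ∈ Ideal.span {f'} * I ⊔ Ideal.span {f} * I' ⊔ Ideal.span {f} ↔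
      ∃ y ∈ I, ∃ z, x = f' * y + f * z := by
    intro x
    rw [Submodule.mem_sup]
    simp only [key, Ideal.mem_span_singleton']
    constructor
    · rintro ⟨_, ⟨y, hy, z, hz, rfl⟩, _, ⟨w, rfl⟩, rfl⟩
      exact ⟨y, hy, z + w, by ring⟩
    · rintro ⟨y, hy, z, rfl⟩
      exact ⟨f' * y + f * 0, ⟨y, hy, 0, I'.zero_mem, rfl⟩, z * f, ⟨z, rfl⟩, by ring⟩
  refine .extend (I' := I') f (fun x => ?_) hI' (.extend (I' := I) f' (fun x => ?_) hI ?_)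
  · rw [key]
    constructor
    · rintro ⟨y, hy, z, hz, h⟩
      obtain ⟨w, rfl⟩ : f ∣ y := hrel.dvd_of_dvd_mul_left (y := f')
        ⟨x - z, by linear_combination -h⟩
      have : x = z + w * f' := mul_left_cancel₀ hf0 (by linear_combination h)
      rw [this]
      exact I'.add_mem hz (I'.mul_mem_left _ hf')
    · intro hx
      exact ⟨0, I.zero_mem, x, hx, by ring⟩
  · rw [key2]
    constructor
    · rintro ⟨y, hy, z, h⟩
      obtain ⟨w, rfl⟩ : f' ∣ z := hrel.symm.dvd_of_dvd_mul_left (y := f)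
        ⟨x - y, by linear_combination -h⟩
      have : x = y + w * f := mul_left_cancel₀ hf0' (by linear_combination h)
      rw [this]
      exact I.add_mem hy (I.mul_mem_left _ hf)
    · intro hx
      exact ⟨x, hx, 0, by ring⟩
  · convert hff' using 1
    ext x
    rw [Submodule.mem_sup, Ideal.mem_span_pair]
    simp only [key2, Ideal.mem_span_singleton']
    constructor
    · rintro ⟨_, ⟨y, hy, z, rfl⟩, _, ⟨w, rfl⟩, rfl⟩
      exact ⟨z, y + w, by ring⟩
    · rintro ⟨z, w, rfl⟩
      exact ⟨f' * 0 + f * z, ⟨0, I.zero_mem, z, rfl⟩, w * f', ⟨w, rfl⟩, by ring⟩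

end Pairs

/-! ### Liaison sums -/

section LiaisonSum

variable {ι : Type*} [DecidableEq ι] (f : ι → R) (I : ι → Ideal R)

/-- The ideal generated by `∏ f` and all the ideals `(∏ f / f i) I i`. -/
def liaisonSum (s : Finset ι) : Ideal R :=
  Ideal.span {∏ j ∈ s, f j} ⊔ ⨆ i ∈ s, Ideal.span {∏ j ∈ s.erase i, f j} * I i

variable {f I} {s : Finset ι}

theorem prod_mem_liaisonSum : ∏ j ∈ s, f j ∈ liaisonSum f I s :=
  Ideal.mem_sup_left (Ideal.mem_span_singleton_self _)

theorem mul_mem_liaisonSum {i : ι} (hi : i ∈ s) {x : R} (hx : x ∈ I i) :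
    (∏ j ∈ s.erase i, f j) * x ∈ liaisonSum f I s :=
  Ideal.mem_sup_right <| (le_iSup₂ (f := fun i _ => Ideal.span {∏ j ∈ s.erase i, f j} * I i) i hi)
    (Ideal.mul_mem_mul (Ideal.mem_span_singleton_self _) hx)

theorem liaisonSum_le {Q : Ideal R} (h0 : ∏ j ∈ s, f j ∈ Q)
    (h : ∀ i ∈ s, ∀ x ∈ I i, (∏ j ∈ s.erase i, f j) * x ∈ Q) : liaisonSum f I s ≤ Q := by
  refine sup_le ((Ideal.span_singleton_le_iff_mem _).2 h0) (iSup₂_le fun i hi => ?_)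
  rw [Ideal.span_singleton_mul_le_iff]
  exact h i hi

/-- This recursive form is a two-term liaison between one index and all the others, which allows
induction on the index set. -/
theorem liaisonSum_insert {i : ι} (hi : i ∉ s) : liaisonSum f I (insert i s) =
    Ideal.span {∏ j ∈ s, f j} * I i ⊔ Ideal.span {f i} * liaisonSum f I s := by
  have h1 : ∀ j ∈ s, (insert i s).erase j = insert i (s.erase j) := fun j hj =>
    Finset.erase_insert_of_ne fun h => hi (h ▸ hj)
  have h2 : ∀ j ∈ s, ∏ m ∈ (insert i s).erase j, f m = f i * ∏ m ∈ s.erase j, f m := by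
    intro j hj
    rw [h1 j hj, Finset.prod_insert (by simp [hi])]
  apply le_antisymm
  · refine liaisonSum_le ?_ ?_
    · rw [Finset.prod_insert hi]
      exact Ideal.mem_sup_right (Ideal.mul_mem_mul (Ideal.mem_span_singleton_self _)
        prod_mem_liaisonSum)
    · intro j hj x hx
      rcases Finset.mem_insert.mp hj with rfl | hj
      · rw [Finset.erase_insert hi]
        exact Ideal.mem_sup_left (Ideal.mul_mem_mul (Ideal.mem_span_singleton_self _) hx)
      · rw [h2 j hj, mul_assoc]
        exact Ideal.mem_sup_right (Ideal.mul_mem_mul (Ideal.mem_span_singleton_self _)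
          (mul_mem_liaisonSum hj hx))
  · refine sup_le ?_ ?_
    · rw [Ideal.span_singleton_mul_le_iff]
      intro x hx
      have := mul_mem_liaisonSum (f := f) (Finset.mem_insert_self i s) hx
      rwa [Finset.erase_insert hi] at this
    · rw [Ideal.span_singleton_mul_le_iff]
      suffices h : liaisonSum f I s ≤
          Submodule.comap (LinearMap.mulLeft R (f i)) (liaisonSum f I (insert i s)) from h
      refine liaisonSum_le ?_ fun j hj x hx => ?_
      · rw [Submodule.mem_comap, LinearMap.mulLeft_apply, ← Finset.prod_insert hi]
        exact prod_mem_liaisonSum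
      · rw [Submodule.mem_comap, LinearMap.mulLeft_apply, ← mul_assoc, ← h2 j hj]
        exact mul_mem_liaisonSum (Finset.mem_insert_of_mem hj) hx

theorem Assembled.liaisonSum [IsDomain R] [DecompositionMonoid R] (hf : ∀ i ∈ s, f i ∈ I i)
    (hI : ∀ i ∈ s, Assembled Ps (I i))
    (hrel : ∀ i ∈ s, ∀ j ∈ s, i ≠ j → IsRelPrime (f i) (f j))
    (hff : ∀ i ∈ s, ∀ j ∈ s, i ≠ j → Assembled Ps (Ideal.span {f i, f j})) :
    Assembled Ps (liaisonSum f I s) := by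
  induction s using Finset.induction_on with
  | empty => 
    convert Assembled.top
    simp [GraphicCM.liaisonSum]
  | insert i s hi ih =>
    have hne : ∀ j ∈ s, i ≠ j := fun j hj h => hi (h ▸ hj)
    rw [liaisonSum_insert hi]
    refine Assembled.liaison (hf i (by simp)) prod_mem_liaisonSum
      (IsRelPrime.prod_right fun j hj => hrel i (by simp) j (by simp [hj]) (hne j hj))
      (hI i (by simp)) (ih ?_ ?_ ?_ ?_) (span_pair_prod s f ?_ ?_)
    · exact fun j hj => hf j (by simp [hj])
    · exact fun j hj => hI j (by simp [hj])
    · exact fun j hj l hl => hrel j (by simp [hj]) l (by simp [hl])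
    · exact fun j hj l hl => hff j (by simp [hj]) l (by simp [hl])
    · exact fun j hj => hrel i (by simp) j (by simp [hj]) (hne j hj)
    · exact fun j hj => hff i (by simp) j (by simp [hj]) (hne j hj)

theorem liaisonSum_le_of_mem {i : ι} (hi : i ∈ s) (hf : f i ∈ I i) : liaisonSum f I s ≤ I i := by
  refine liaisonSum_le ?_ fun j hj x hx => ?_
  · exact Ideal.mem_of_dvd _ (Finset.dvd_prod_of_mem f hi) hf
  · rcases eq_or_ne j i with rfl | hne
    · exact Ideal.mul_mem_left _ _ hx
    · exact Ideal.mul_mem_right _ _ (Ideal.mem_of_dvd _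
        (Finset.dvd_prod_of_mem f (Finset.mem_erase.mpr ⟨hne.symm, hi⟩)) hf)

theorem liaisonSum_le_of_mem_of_mem {Q : Ideal R} {i j : ι} (hi : i ∈ s) (hj : j ∈ s) (hij : i ≠ j)
    (hfi : f i ∈ Q) (hfj : f j ∈ Q) : liaisonSum f I s ≤ Q := by
  refine liaisonSum_le ?_ fun m hm x hx => Ideal.mul_mem_right _ _ ?_
  · exact Ideal.mem_of_dvd _ (Finset.dvd_prod_of_mem f hi) hfi
  · rcases eq_or_ne m i with rfl | hne
    · exact Ideal.mem_of_dvd _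
        (Finset.dvd_prod_of_mem f (Finset.mem_erase.mpr ⟨hij.symm, hj⟩)) hfj
    · exact Ideal.mem_of_dvd _
        (Finset.dvd_prod_of_mem f (Finset.mem_erase.mpr ⟨hne.symm, hi⟩)) hfi

end LiaisonSum

end Assembled

/-! ### Detecting the radical and the height two part locally -/

section Local

variable {R : Type*} [CommRing R] {Ps : Set (Ideal R)} {J : Ideal R}

/-- Membership in `D` may be tested locally at the members of `Ps`, where `D` coincides with the
prime itself. -/
theorem radical_eq_of_assembled (hPs : ∀ P ∈ Ps, P.IsPrime) (hJ : ∀ P ∈ Ps, J ≤ P)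
    (hmin : ∀ Q : Ideal R, Q.IsPrime → J ≤ Q → ∃ P ∈ Ps, P ≤ Q) {D : Ideal R}
    (hD : Assembled Ps D) (hDP : ∀ P ∈ Ps, D ≤ P) (hloc : ∀ P ∈ Ps, ∃ s ∉ P, ∀ x ∈ P, s * x ∈ D) :
    J.radical = D := by
  apply le_antisymm
  · intro x hx
    refine hD.mem_of_forall hPs fun P hP => ?_
    obtain ⟨s, hs, h⟩ := hloc P hP
    exact ⟨s, hs, h x ((hPs P hP).radical_le_iff.mpr (hJ P hP) hx)⟩
  · rw [Ideal.radical_eq_sInf]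
    refine le_sInf fun Q ⟨hQ, hQp⟩ => ?_
    obtain ⟨P, hP, hPQ⟩ := hmin Q hQp hQ
    exact (hDP P hP).trans hPQ

theorem heightTwoPart_eq_of_assembled [IsNoetherianRing R] (hPs : ∀ P ∈ Ps, P.IsPrime)
    (hht : ∀ P ∈ Ps, P.height = 2)
    (hmin : ∀ Q : Ideal R, Q.IsPrime → J ≤ Q → ∃ P ∈ Ps, P ≤ Q) {D : Ideal R}
    (hD : Assembled Ps D) (hJD : J ≤ D) (hloc : ∀ P ∈ Ps, ∃ s ∉ P, ∀ x ∈ D, s * x ∈ J) {K : Ideal R}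
    (hK : IsHeightTwoPart J K) : K = D := by
  obtain ⟨t, ht, rfl⟩ := hK
  have hprim : ∀ q ∈ t, Ideal.IsPrimary q := fun q hq => ht.primary hq
  have hJq : ∀ q ∈ t, J ≤ q := fun q hq => by
    rw [← ht.inf_eq]; exact Finset.inf_le hq
  apply le_antisymm
  · intro x hx
    simp only [Set.mem_ofPred_eq, Submodule.mem_iInf, and_imp] at hx
    refine hD.mem_of_forall hPs fun P hP => ?_
    have hPp := hPs P hP
    -- A component whose radical is not inside `P` becomes trivial at `P`. If the radical is inside
    -- `P`, it contains a member of `Ps` of the same height as `P`, so it equals `P` and the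
    -- component is one of those intersected.
    have hs : ∀ q ∈ t, ∃ s ∉ P, s * x ∈ q := by
      intro q hq
      by_cases hqP : q.radical ≤ P
      · have hqp := Ideal.isPrime_radical (hprim q hq)
        obtain ⟨P', hP', hle⟩ := hmin q.radical hqp ((hJq q hq).trans Ideal.le_radical)
        have := hPs P' hP'
        have e : P' = P := Ideal.eq_of_le_of_height_le _ (hle.trans hqP)
          (by rw [hht P hP, hht P' hP'])
        have e' : q.radical = P := le_antisymm hqP (e ▸ hle)
        exact ⟨1, (Ideal.ne_top_iff_one P).1 hPp.ne_top, by
          simpa using hx q hq (by rw [e', hht P hP])⟩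
      · obtain ⟨s, hs, hsP⟩ := SetLike.not_le_iff_exists.mp hqP
        obtain ⟨n, hn⟩ := hs
        exact ⟨s ^ n, fun h => hsP (hPp.mem_of_pow_mem n h), Ideal.mul_mem_right _ _ hn⟩
    choose! s hsP hsx using hs
    refine ⟨∏ q ∈ t, s q, fun h => ?_, hJD ?_⟩
    · obtain ⟨q, hq, h⟩ := (hPp.prod_mem_iff).mp h
      exact hsP q hq h
    · rw [← ht.inf_eq, Submodule.mem_finsetInf]
      intro q hq
      obtain ⟨c, hc⟩ := Finset.dvd_prod_of_mem s hq
      rw [id, hc, mul_right_comm]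
      exact Ideal.mul_mem_right _ _ (hsx q hq)
  · refine le_iInf₂ fun q hq x hx => ?_
    obtain ⟨hqt, hq2⟩ := hq
    have hqp := Ideal.isPrime_radical (hprim q hqt)
    obtain ⟨P, hP, hle⟩ := hmin q.radical hqp ((hJq q hqt).trans Ideal.le_radical)
    have := hPs P hP
    have e : P = q.radical := Ideal.eq_of_le_of_height_le _ hle (by rw [hht P hP, hq2])
    obtain ⟨s, hs, h⟩ := hloc P hP
    have hsx := hJq q hqt (h x hx)
    -- The multiplier `s` lies outside the radical of the primary ideal `q`, so it can be cancelled.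
    rw [mul_comm] at hsx
    rcases (Ideal.isPrimary_iff.mp (hprim q hqt)).2 hsx with h' | h'
    · exact h'
    · exact absurd h' (e ▸ hs)

end Local

open MvPolynomial

/-! ### Generic finite free coordinates modulo pairs of linear forms -/

section Linear

variable {k : Type*} [Field k] {σ : Type*} [Fintype σ]

/-- The linear form with the given coefficients. -/
noncomputable def linForm : (σ → k) →ₗ[k] MvPolynomial σ k :=
  Fintype.linearCombination k (fun i => (X i : MvPolynomial σ k))

theorem linForm_single [DecidableEq σ] (i : σ) : linForm (Pi.single i (1 : k)) = X i := by
  simp [linForm]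

/-- Let `W` be the space of linear forms vanishing at the points `p` and `q`. The determinant
condition says exactly that `l`, `l'` span a complement of `W`. So the polynomial ring on `W`,
chosen independently of `l` and `l'`, maps isomorphically onto the quotient by `(l, l')`. -/
theorem exists_retraction (p q : σ → k) : ∃ (m : ℕ)
    (φ : MvPolynomial (Fin m) k →ₐ[k] MvPolynomial σ k), ∀ l l' : σ → k,
      (l ⬝ᵥ p) * (l' ⬝ᵥ q) - (l' ⬝ᵥ p) * (l ⬝ᵥ q) ≠ 0 →
      ∃ ψ : MvPolynomial σ k →ₐ[k] MvPolynomial (Fin m) k, (∀ y, ψ (φ y) = y) ∧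
        ψ (linForm l) = 0 ∧ ψ (linForm l') = 0 ∧
        ∀ r, r - φ (ψ r) ∈ Ideal.span {linForm l, linForm l'} := by
  classical
  let P : (σ → k) →ₗ[k] k := (dotProductBilin k k).flip p
  let Q : (σ → k) →ₗ[k] k := (dotProductBilin k k).flip q
  let W : Submodule k (σ → k) := LinearMap.ker P ⊓ LinearMap.ker Q
  let b := Module.finBasis k W
  let φ : MvPolynomial (Fin (Module.finrank k W)) k →ₐ[k] MvPolynomial σ k :=
    aeval fun j => linForm (b j : σ → k)
  let linA : W →ₗ[k] MvPolynomial (Fin (Module.finrank k W)) k := b.constr k X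
  have hφ : ∀ w : W, φ (linA w) = linForm (w : σ → k) := by
    intro w
    have : φ.toLinearMap ∘ₗ linA = linForm ∘ₗ W.subtype := b.ext fun j => by
      simp [linA, φ]
    exact LinearMap.congr_fun this w
  refine ⟨_, φ, fun l l' hdet => ?_⟩
  set Δ := (l ⬝ᵥ p) * (l' ⬝ᵥ q) - (l' ⬝ᵥ p) * (l ⬝ᵥ q) with hΔ
  -- By Cramer's rule, `α v` and `β v` are the coefficients for which `v - α v • l - β v • l'`
  -- vanishes at both points.
  let α : (σ → k) →ₗ[k] k := Δ⁻¹ • ((l' ⬝ᵥ q) • P - (l' ⬝ᵥ p) • Q)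
  let β : (σ → k) →ₗ[k] k := Δ⁻¹ • ((l ⬝ᵥ p) • Q - (l ⬝ᵥ q) • P)
  have hP : ∀ v, P v = v ⬝ᵥ p := fun v => rfl
  have hQ : ∀ v, Q v = v ⬝ᵥ q := fun v => rfl
  have hα : ∀ v, α v = Δ⁻¹ * ((l' ⬝ᵥ q) * (v ⬝ᵥ p) - (l' ⬝ᵥ p) * (v ⬝ᵥ q)) := fun v => rfl
  have hβ : ∀ v, β v = Δ⁻¹ * ((l ⬝ᵥ p) * (v ⬝ᵥ q) - (l ⬝ᵥ q) * (v ⬝ᵥ p)) := fun v => rfl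
  let π₀ : (σ → k) →ₗ[k] (σ → k) := LinearMap.id - α.smulRight l - β.smulRight l'
  have hπ₀ : ∀ v, π₀ v = v - α v • l - β v • l' := fun v => rfl
  have hmem : ∀ v, π₀ v ∈ W := by
    intro v
    refine ⟨?_, ?_⟩
    · rw [SetLike.mem_coe, LinearMap.mem_ker, hπ₀, hP, sub_dotProduct, sub_dotProduct,
        smul_dotProduct, smul_dotProduct, hα, hβ, smul_eq_mul, smul_eq_mul]
      field_simp
      rw [hΔ]; ring
    · rw [SetLike.mem_coe, LinearMap.mem_ker, hπ₀, hQ, sub_dotProduct, sub_dotProduct,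
        smul_dotProduct, smul_dotProduct, hα, hβ, smul_eq_mul, smul_eq_mul]
      field_simp
      rw [hΔ]; ring
  let π : (σ → k) →ₗ[k] W := π₀.codRestrict W hmem
  have hπW : ∀ w : W, π w = w := by
    intro w
    apply Subtype.ext
    have h1 : (w : σ → k) ⬝ᵥ p = 0 := w.2.1
    have h2 : (w : σ → k) ⬝ᵥ q = 0 := w.2.2
    change π₀ w = w
    rw [hπ₀, hα, hβ, h1, h2]
    simp
  have hαl : α l = 1 := by
    rw [hα, inv_mul_eq_one₀ hdet, hΔ]; ring
  have hβl : β l = 0 := by rw [hβ]; ring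
  have hαl' : α l' = 0 := by rw [hα]; ring
  have hβl' : β l' = 1 := by
    rw [hβ, inv_mul_eq_one₀ hdet, hΔ]; ring
  let ψ : MvPolynomial σ k →ₐ[k] MvPolynomial (Fin (Module.finrank k W)) k :=
    aeval fun i => linA (π (Pi.single i 1))
  have hψ : ∀ v, ψ (linForm v) = linA (π v) := by
    intro v
    have : ψ.toLinearMap ∘ₗ linForm = linA ∘ₗ π := by
      refine LinearMap.pi_ext' fun i => LinearMap.ext_ring ?_
      simp [ψ, linForm_single]
    exact LinearMap.congr_fun this v
  refine ⟨ψ, fun y => ?_, ?_, ?_, fun r => ?_⟩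
  · have : ψ.comp φ = AlgHom.id k _ := by
      refine MvPolynomial.algHom_ext fun j => ?_
      simp [φ, hψ, hπW, linA]
    exact AlgHom.congr_fun this y
  · rw [hψ]
    have : π l = 0 := Subtype.ext (by change π₀ l = 0; rw [hπ₀, hαl, hβl]; simp)
    rw [this, map_zero]
  · rw [hψ]
    have : π l' = 0 := Subtype.ext (by change π₀ l' = 0; rw [hπ₀, hαl', hβl']; simp)
    rw [this, map_zero]
  · rw [← Ideal.Quotient.eq]
    have : Ideal.Quotient.mkₐ k (Ideal.span {linForm l, linForm l'}) =
        (Ideal.Quotient.mkₐ k (Ideal.span {linForm l, linForm l'})).comp (φ.comp ψ) := by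
      refine MvPolynomial.algHom_ext fun i => ?_
      simp only [Ideal.Quotient.mkₐ_eq_mk, AlgHom.comp_apply]
      rw [Ideal.Quotient.eq, ← linForm_single i, hψ, hφ, ← map_sub]
      change linForm (_ - π₀ _) ∈ _
      rw [hπ₀, Ideal.mem_span_pair]
      refine ⟨C (α (Pi.single i 1)), C (β (Pi.single i 1)), ?_⟩
      rw [← smul_eq_C_mul, ← smul_eq_C_mul, ← map_smul, ← map_smul, ← map_add]
      congr 1
      abel
    exact AlgHom.congr_fun this r

end Linear

/-! ### Quotients identified with a ring by a retraction -/

section Retraction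

variable {A R : Type*} [CommRing A] [CommRing R]

theorem isPrime_of_retraction [IsDomain A] {P : Ideal R} (φ : A →+* R) (ψ : R →+* A)
    (hP : P ≤ RingHom.ker ψ) (h : ∀ r, r - φ (ψ r) ∈ P) : P.IsPrime := by
  have : P = RingHom.ker ψ := le_antisymm hP fun r hr => by
    have := h r
    rwa [(RingHom.mem_ker).1 hr, map_zero, sub_zero] at this
  rw [this]
  exact RingHom.ker_isPrime ψ

theorem finite_projective_of_retraction [Algebra A R] {P : Ideal R} (ψ : R →+* A)
    (hψ : ∀ a, ψ (algebraMap A R a) = a) (hP : P ≤ RingHom.ker ψ)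
    (h : ∀ r, r - algebraMap A R (ψ r) ∈ P) :
    Module.Finite A (R ⧸ P) ∧ Module.Projective A (R ⧸ P) := by
  have hb : Function.Bijective (Algebra.linearMap A (R ⧸ P)) := by
    constructor
    · rw [injective_iff_map_eq_zero]
      intro a ha
      have : algebraMap A R a ∈ P := Ideal.Quotient.eq_zero_iff_mem.mp ha
      rw [← hψ a]
      exact hP this
    · intro r
      obtain ⟨r, rfl⟩ := Ideal.Quotient.mk_surjective r
      exact ⟨ψ r, (Ideal.Quotient.eq.mpr (h r)).symm⟩
  let e := LinearEquiv.ofBijective _ hb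
  exact ⟨Module.Finite.equiv e, Module.Projective.of_equiv e⟩

end Retraction

/-! ### The forms `x_i - x_j` -/

section EdgeForm

variable (k : Type*) [Field k] {σ : Type*}

/-- The linear form `x_i - x_j`. -/
noncomputable def edgeForm (e : σ × σ) : MvPolynomial σ k := X e.1 - X e.2

variable {k}

/-- The substitution identifying `e.2` with `e.1`. -/
def collapse [DecidableEq σ] (e : σ × σ) (i : σ) : σ := if i = e.2 then e.1 else i

theorem edgeForm_eq_linForm [Fintype σ] [DecidableEq σ] (e : σ × σ) :
    edgeForm k e = linForm (Pi.single e.1 1 - Pi.single e.2 1) := by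
  simp [edgeForm, linForm_single]

theorem rename_edgeForm {τ : Type*} (w : σ → τ) (e : σ × σ) :
    rename w (edgeForm k e) = edgeForm k (w e.1, w e.2) := by
  simp [edgeForm]

theorem edgeForm_eq_zero_iff {e : σ × σ} : edgeForm k e = 0 ↔ e.1 = e.2 := by
  rw [edgeForm, sub_eq_zero, X_inj]

theorem eq_of_edgeForm_mem_span {τ : Type*} (w : σ → τ) {S : Set (MvPolynomial σ k)}
    (hS : ∀ x ∈ S, rename w x = 0) {e : σ × σ} (h : edgeForm k e ∈ Ideal.span S) :
    w e.1 = w e.2 := by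
  have hle : Ideal.span S ≤ RingHom.ker (rename w : MvPolynomial σ k →ₐ[k] MvPolynomial τ k) :=
    Ideal.span_le.mpr fun x hx => (RingHom.mem_ker).2 (hS x hx)
  have := (RingHom.mem_ker).1 (hle h)
  rwa [rename_edgeForm, edgeForm_eq_zero_iff] at this

theorem prime_edgeForm {e : σ × σ} (he : e.1 ≠ e.2) : Prime (edgeForm k e) := by
  classical
  rw [← Ideal.span_singleton_prime (mt edgeForm_eq_zero_iff.1 he)]
  -- Modulo `x_i - x_j`, replacing `x_j` by `x_i` changes nothing, so the ideal is the kernel of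
  -- this substitution into a domain.
  let ψ : MvPolynomial σ k →ₐ[k] MvPolynomial σ k := rename (collapse e)
  refine isPrime_of_retraction (A := MvPolynomial σ k) (RingHom.id _) ψ.toRingHom ?_ ?_
  · rw [Ideal.span_singleton_le_iff_mem]
    refine (RingHom.mem_ker).2 ?_
    change rename (collapse e) _ = 0
    rw [rename_edgeForm, edgeForm_eq_zero_iff]
    simp [collapse]
  · intro r
    rw [← Ideal.Quotient.eq]
    have : Ideal.Quotient.mkₐ k (Ideal.span {edgeForm k e}) =
        (Ideal.Quotient.mkₐ k (Ideal.span {edgeForm k e})).comp ψ := by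
      refine MvPolynomial.algHom_ext fun i => ?_
      simp only [Ideal.Quotient.mkₐ_eq_mk, AlgHom.comp_apply]
      rw [Ideal.Quotient.eq]
      simp only [ψ, rename_X, collapse]
      split_ifs with h
      · rw [h, ← neg_sub]
        exact neg_mem (Ideal.mem_span_singleton_self _)
      · simp
    exact AlgHom.congr_fun this r

theorem not_edgeForm_dvd [LinearOrder σ] {e e' : σ × σ} (he : e.1 < e.2) (he' : e'.1 < e'.2)
    (hne : e ≠ e') : ¬ edgeForm k e ∣ edgeForm k e' := by
  intro h
  have := eq_of_edgeForm_mem_span (k := k) (collapse e) (S := {edgeForm k e}) (by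
    simp [rename_edgeForm, edgeForm_eq_zero_iff, collapse]) (Ideal.mem_span_singleton.mpr h)
  obtain ⟨a, b⟩ := e
  obtain ⟨c, d⟩ := e'
  simp only [collapse] at *
  grind

theorem isRelPrime_edgeForm [LinearOrder σ] {e e' : σ × σ} (he : e.1 < e.2) (he' : e'.1 < e'.2)
    (hne : e ≠ e') : IsRelPrime (edgeForm k e) (edgeForm k e') :=
  (prime_edgeForm he.ne).irreducible.isRelPrime_iff_not_dvd.mpr (not_edgeForm_dvd he he' hne)

end EdgeForm

/-! ### Coordinates generic for all codimension two flats -/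

section Generic

variable {k : Type*} [Field k] [CharZero k] {n : ℕ}

/-- Uniqueness of binary expansions: the powers of two form a Sidon set. -/
theorem two_pow_add_two_pow_ne {a b c d : ℕ} (hab : a < b) (hcd : c < d)
    (hne : (a, b) ≠ (c, d)) : 2 ^ a + 2 ^ b ≠ 2 ^ c + 2 ^ d := by
  have key : ∀ {a b c d : ℕ}, a < b → c < d → b < d → 2 ^ a + 2 ^ b ≠ 2 ^ c + 2 ^ d := by
    intro a b c d hab hcd hbd h
    have h1 : 2 ^ a < 2 ^ b := Nat.pow_lt_pow_right one_lt_two hab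
    have h2 : 2 ^ (b + 1) ≤ 2 ^ d := Nat.pow_le_pow_right two_pos hbd
    have h3 : 0 < 2 ^ c := Nat.two_pow_pos c
    rw [pow_succ] at h2
    omega
  intro h
  rcases lt_trichotomy b d with hbd | rfl | hbd
  · exact key hab hcd hbd h
  · have : 2 ^ a = 2 ^ c := by omega
    exact hne (by rw [Nat.pow_right_injective le_rfl this])
  · exact key hcd hab hbd h.symm

theorem exists_generic_coordinates (k : Type*) [Field k] [CharZero k] (n : ℕ) : ∃ (m : ℕ)
    (φ : MvPolynomial (Fin m) k →ₐ[k] MvPolynomial (Fin n) k),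
      ∀ e e' : Fin n × Fin n, e.1 < e.2 → e'.1 < e'.2 → e ≠ e' →
      ∃ ψ : MvPolynomial (Fin n) k →ₐ[k] MvPolynomial (Fin m) k, (∀ y, ψ (φ y) = y) ∧
        Ideal.span {edgeForm k e, edgeForm k e'} ≤ RingHom.ker ψ.toRingHom ∧
        ∀ r, r - φ (ψ r) ∈ Ideal.span {edgeForm k e, edgeForm k e'} := by
  -- With points `(t_i)` and `(t_i ^ 2)`, the determinant for edges `(a, b)` and `(c, d)` is `(t_a -
  -- t_b)(t_c - t_d)(t_c + t_d - t_a - t_b)`. The choice `t_i = 2 ^ i` makes every factor nonzero in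
  -- characteristic zero.
  obtain ⟨m, φ, h⟩ := exists_retraction (fun i : Fin n => (2 : k) ^ (i : ℕ))
    (fun i => ((2 : k) ^ (i : ℕ)) ^ 2)
  refine ⟨m, φ, fun e e' he he' hne => ?_⟩
  have hpow : ∀ {a b : Fin n}, a < b → (2 : k) ^ (a : ℕ) - 2 ^ (b : ℕ) ≠ 0 := by
    intro a b hab h
    have : 2 ^ (a : ℕ) = 2 ^ (b : ℕ) := by exact_mod_cast sub_eq_zero.mp h
    exact hab.ne (Fin.ext (Nat.pow_right_injective le_rfl this))
  have hsidon : (2 : k) ^ (e'.1 : ℕ) + 2 ^ (e'.2 : ℕ) - (2 ^ (e.1 : ℕ) + 2 ^ (e.2 : ℕ)) ≠ 0 := by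
    intro h
    refine two_pow_add_two_pow_ne (a := e'.1) (b := e'.2) (c := e.1) (d := e.2) he' he ?_ ?_
    · intro heq
      simp only [Prod.mk.injEq] at heq
      exact hne (Prod.ext (Fin.ext heq.1.symm) (Fin.ext heq.2.symm))
    · exact_mod_cast sub_eq_zero.mp h
  obtain ⟨ψ, h1, h2, h3, h4⟩ := h (Pi.single e.1 1 - Pi.single e.2 1)
    (Pi.single e'.1 1 - Pi.single e'.2 1) (by
      simp only [sub_dotProduct, single_dotProduct, one_mul]
      convert mul_ne_zero (mul_ne_zero (hpow he) (hpow he')) hsidon using 1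
      ring)
  rw [← edgeForm_eq_linForm] at h2 h3 h4
  rw [← edgeForm_eq_linForm] at h4
  refine ⟨ψ, h1, ?_, h4⟩
  rw [Ideal.span_le]
  rintro x (rfl | rfl)
  · exact h2
  · exact h3

variable {e e' : Fin n × Fin n}

theorem isPrime_span_edgeForm_pair (he : e.1 < e.2) (he' : e'.1 < e'.2) (hne : e ≠ e') :
    (Ideal.span {edgeForm k e, edgeForm k e'}).IsPrime := by
  obtain ⟨m, φ, h⟩ := exists_generic_coordinates k n
  obtain ⟨ψ, -, h2, h3⟩ := h e e' he he' hne
  exact isPrime_of_retraction φ.toRingHom ψ.toRingHom h2 h3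

/-- Krull's height theorem bounds the height above; the chain of primes `0 < (l) < (l, l')` bounds
it below. -/
theorem height_span_edgeForm_pair (he : e.1 < e.2) (he' : e'.1 < e'.2) (hne : e ≠ e') :
    (Ideal.span {edgeForm k e, edgeForm k e'}).height = 2 := by
  have hP := isPrime_span_edgeForm_pair (k := k) he he' hne
  apply le_antisymm
  · refine (Ideal.height_le_card_of_mem_minimalPrimes_span (s := {edgeForm k e, edgeForm k e'})
      (by simp) ?_).trans ?_
    · rw [Ideal.minimalPrimes_eq_subsingleton_self]
      rfl
    · exact_mod_cast (Set.ncard_insert_le _ _).trans (by simp)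
  · have hl : (Ideal.span {edgeForm k e}).IsPrime :=
      (Ideal.span_singleton_prime (prime_edgeForm he.ne).ne_zero).mpr (prime_edgeForm he.ne)
    have h1 : (⊥ : Ideal (MvPolynomial (Fin n) k)) < Ideal.span {edgeForm k e} := by
      rw [bot_lt_iff_ne_bot, Ne, Ideal.span_singleton_eq_bot]
      exact (prime_edgeForm he.ne).ne_zero
    have h2 : Ideal.span {edgeForm k e} < Ideal.span {edgeForm k e, edgeForm k e'} := by
      refine lt_of_le_of_ne (Ideal.span_mono (by simp)) fun h =>
        not_edgeForm_dvd (k := k) he he' hne ?_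
      rw [← Ideal.mem_span_singleton, h]
      exact Ideal.subset_span (by simp)
    have h3 := Ideal.height_add_one_le_of_lt_of_isPrime h1
    have h4 := Ideal.height_add_one_le_of_lt_of_isPrime h2
    have : (2 : ℕ∞) = 0 + 1 + 1 := by norm_num
    rw [this]
    refine le_trans ?_ h4
    gcongr
    exact le_trans (by simp) h3

end Generic

/-! ### Classes of edges of a graph with edge disjoint triangles -/

section Graph

variable {n : ℕ} (G : SimpleGraph (Fin n))

/-- The vertices `i < j < m` form a 3-cycle. -/
structure IsTriangle (i j m : Fin n) : Prop where
  lt_left : i < j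
  lt_right : j < m
  adj_left : G.Adj i j
  adj_right : G.Adj j m
  adj_outer : G.Adj i m

/-- The three edges of a 3-cycle. -/
def triangleEdges (i j m : Fin n) : Finset (Fin n × Fin n) := {(i, j), (j, m), (i, m)}

open Classical in
/-- The edges of a graph, as increasing pairs. -/
noncomputable def orderedEdges : Finset (Fin n × Fin n) :=
  Finset.univ.filter fun e => e.1 < e.2 ∧ G.Adj e.1 e.2

open Classical in
/-- The edges of the 3-cycles through an edge `e`, and `e` itself. -/
noncomputable def edgeClass (e : Fin n × Fin n) : Finset (Fin n × Fin n) :=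
  (orderedEdges G).filter fun e' => e' = e ∨
    ∃ i j m, IsTriangle G i j m ∧ e ∈ triangleEdges i j m ∧ e' ∈ triangleEdges i j m

/-- The classes of edges. -/
noncomputable def edgeClasses : Finset (Finset (Fin n × Fin n)) :=
  (orderedEdges G).image (edgeClass G)

variable {G}

theorem mem_orderedEdges {e : Fin n × Fin n} :
    e ∈ orderedEdges G ↔ e.1 < e.2 ∧ G.Adj e.1 e.2 := by
  simp [orderedEdges]

theorem mem_triangleEdges {i j m : Fin n} {e : Fin n × Fin n} :
    e ∈ triangleEdges i j m ↔ e = (i, j) ∨ e = (j, m) ∨ e = (i, m) := by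
  simp [triangleEdges]

theorem mem_edgeClass_self {e : Fin n × Fin n} (he : e ∈ orderedEdges G) : e ∈ edgeClass G e := by
  simp [edgeClass, he]

theorem edgeClass_subset (e : Fin n × Fin n) : edgeClass G e ⊆ orderedEdges G := by
  simp [edgeClass]

theorem mem_edgeClasses {c : Finset (Fin n × Fin n)} :
    c ∈ edgeClasses G ↔ ∃ e ∈ orderedEdges G, edgeClass G e = c := by
  simp [edgeClasses]

theorem IsTriangle.subset {i j m : Fin n} (h : IsTriangle G i j m) :
    triangleEdges i j m ⊆ orderedEdges G := by
  intro e he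
  rw [mem_orderedEdges]
  rcases mem_triangleEdges.mp he with rfl | rfl | rfl
  · exact ⟨h.lt_left, h.adj_left⟩
  · exact ⟨h.lt_right, h.adj_right⟩
  · exact ⟨h.lt_left.trans h.lt_right, h.adj_outer⟩

theorem IsTriangle.unique (hG : G.EdgeDisjointTriangles) {i j m i' j' m' : Fin n}
    (h : IsTriangle G i j m) (h' : IsTriangle G i' j' m') {e : Fin n × Fin n}
    (he : e ∈ triangleEdges i j m) (he' : e ∈ triangleEdges i' j' m') :
    i = i' ∧ j = j' ∧ m = m' := by
  have hlt := (mem_orderedEdges.mp (h.subset he)).1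
  have hset : ({i, j, m} : Finset (Fin n)) = {i', j', m'} := by
    by_contra hne
    have hsub := hG (x := {i, j, m}) (y := {i', j', m'})
      (SimpleGraph.is3Clique_triple_iff.mpr ⟨h.adj_left, h.adj_outer, h.adj_right⟩)
      (SimpleGraph.is3Clique_triple_iff.mpr ⟨h'.adj_left, h'.adj_outer, h'.adj_right⟩) hne
    refine hlt.ne (hsub ⟨?_, ?_⟩ ⟨?_, ?_⟩)
    · rcases mem_triangleEdges.mp he with rfl | rfl | rfl <;> simp
    · rcases mem_triangleEdges.mp he' with rfl | rfl | rfl <;> simp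
    · rcases mem_triangleEdges.mp he with rfl | rfl | rfl <;> simp
    · rcases mem_triangleEdges.mp he' with rfl | rfl | rfl <;> simp
  have h1 := h.lt_left
  have h2 := h.lt_right
  have h3 := h'.lt_left
  have h4 := h'.lt_right
  have key : ∀ x, (x = i ∨ x = j ∨ x = m) ↔ (x = i' ∨ x = j' ∨ x = m') := by
    intro x
    have := Finset.ext_iff.mp hset x
    simpa using this
  have a1 := (key i).1 (by simp)
  have a2 := (key j).1 (by simp)
  have a3 := (key m).1 (by simp)
  clear key hset he he' hlt h h'
  omega

theorem IsTriangle.edgeClass_eq (hG : G.EdgeDisjointTriangles) {i j m : Fin n}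
    (h : IsTriangle G i j m) {e : Fin n × Fin n} (he : e ∈ triangleEdges i j m) :
    edgeClass G e = triangleEdges i j m := by
  ext e'
  simp only [edgeClass, Finset.mem_filter]
  constructor
  · rintro ⟨-, rfl | ⟨i', j', m', h', he1, he2⟩⟩
    · exact he
    · obtain ⟨rfl, rfl, rfl⟩ := h.unique hG h' he he1
      exact he2
  · intro he'
    exact ⟨h.subset he', Or.inr ⟨i, j, m, h, he, he'⟩⟩

theorem edgeClass_eq_singleton_or (hG : G.EdgeDisjointTriangles) {e : Fin n × Fin n}
    (he : e ∈ orderedEdges G) : edgeClass G e = {e} ∨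
      ∃ i j m, IsTriangle G i j m ∧ e ∈ triangleEdges i j m ∧
        edgeClass G e = triangleEdges i j m := by
  by_cases h : ∃ i j m, IsTriangle G i j m ∧ e ∈ triangleEdges i j m
  · obtain ⟨i, j, m, h, he'⟩ := h
    exact Or.inr ⟨i, j, m, h, he', h.edgeClass_eq hG he'⟩
  · refine Or.inl (Finset.ext fun e' => ?_)
    simp only [edgeClass, Finset.mem_filter, Finset.mem_singleton]
    constructor
    · rintro ⟨-, rfl | ⟨i, j, m, h', he1, -⟩⟩
      · rfl
      · exact absurd ⟨i, j, m, h', he1⟩ h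
    · rintro rfl
      exact ⟨he, Or.inl rfl⟩

theorem eq_singleton_or_of_mem_edgeClasses (hG : G.EdgeDisjointTriangles)
    {c : Finset (Fin n × Fin n)} (hc : c ∈ edgeClasses G) :
    (∃ e ∈ orderedEdges G, c = {e}) ∨ ∃ i j m, IsTriangle G i j m ∧ c = triangleEdges i j m := by
  obtain ⟨e, he, rfl⟩ := mem_edgeClasses.mp hc
  rcases edgeClass_eq_singleton_or hG he with h | ⟨i, j, m, h, -, h'⟩
  · exact Or.inl ⟨e, he, h⟩
  · exact Or.inr ⟨i, j, m, h, h'⟩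

theorem edgeClass_eq_of_mem (hG : G.EdgeDisjointTriangles) {c : Finset (Fin n × Fin n)}
    (hc : c ∈ edgeClasses G) {e : Fin n × Fin n} (he : e ∈ c) :
    e ∈ orderedEdges G ∧ edgeClass G e = c := by
  obtain ⟨e', he', rfl⟩ := mem_edgeClasses.mp hc
  refine ⟨edgeClass_subset _ he, ?_⟩
  rcases edgeClass_eq_singleton_or hG he' with h | ⟨i, j, m, h, -, h'⟩
  · rw [h, Finset.mem_singleton] at he
    rw [he]
  · rw [h'] at he ⊢
    exact h.edgeClass_eq hG he

/-- The classes are the fibres of `edgeClass`, hence partition the edges; this is where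
edge-disjointness enters. -/
theorem prod_edgeClasses (hG : G.EdgeDisjointTriangles) {M : Type*} [CommMonoid M]
    (f : Fin n × Fin n → M) :
    ∏ c ∈ edgeClasses G, ∏ e ∈ c, f e = ∏ e ∈ orderedEdges G, f e := by
  classical
  rw [← Finset.prod_fiberwise_of_maps_to (t := edgeClasses G) (g := edgeClass G)
    fun e he => mem_edgeClasses.mpr ⟨e, he, rfl⟩]
  refine Finset.prod_congr rfl fun c hc => Finset.prod_congr (Finset.ext fun e => ?_) fun _ _ => rfl
  rw [Finset.mem_filter]
  exact ⟨fun he => edgeClass_eq_of_mem hG hc he, fun he => he.2 ▸ mem_edgeClass_self he.1⟩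

/-- Which edges vanish on the flat where two given edges vanish. -/
theorem eq_or_eq_or_triangle_of_mem_span {k : Type*} [Field k] {e e' e'' : Fin n × Fin n}
    (he : e ∈ orderedEdges G) (he' : e' ∈ orderedEdges G) (he'' : e'' ∈ orderedEdges G)
    (hne : e ≠ e') (h : edgeForm k e'' ∈ Ideal.span {edgeForm k e, edgeForm k e'}) :
    e'' = e ∨ e'' = e' ∨ ∃ i j m, IsTriangle G i j m ∧ e ∈ triangleEdges i j m ∧
      e' ∈ triangleEdges i j m ∧ e'' ∈ triangleEdges i j m := by
  -- The inner collapse contracts `e` and the outer one contracts the image of `e'`; any edge form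
  -- in the span must then have its two ends identified.
  have hw := eq_of_edgeForm_mem_span
    (fun x => collapse (collapse e e'.1, collapse e e'.2) (collapse e x)) (by
      rintro x (rfl | rfl) <;> rw [rename_edgeForm, edgeForm_eq_zero_iff] <;> dsimp only
      · simp [collapse]
      · simp only [collapse]
        split_ifs <;> simp_all) h
  obtain ⟨a, b⟩ := e
  obtain ⟨c, d⟩ := e'
  obtain ⟨x, y⟩ := e''
  rw [mem_orderedEdges] at he he' he''
  obtain ⟨hab, Gab⟩ := he
  obtain ⟨hcd, Gcd⟩ := he'
  obtain ⟨hxy, Gxy⟩ := he''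
  simp only [Prod.mk.injEq, ne_eq, mem_triangleEdges] at *
  by_cases hX : x = a ∧ y = b
  · exact Or.inl hX
  by_cases hY : x = c ∧ y = d
  · exact Or.inr (Or.inl hY)
  refine Or.inr (Or.inr ?_)
  -- The remaining possibility is that `e` and `e'` share a vertex and `e''` joins their other ends;
  -- the cases are the positions of the shared vertex.
  have hcases : (a = c ∧ ((x = b ∧ y = d) ∨ (x = d ∧ y = b))) ∨
      (b = d ∧ ((x = a ∧ y = c) ∨ (x = c ∧ y = a))) ∨
      (b = c ∧ x = a ∧ y = d) ∨ (a = d ∧ x = c ∧ y = b) := by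
    clear h Gab Gcd Gxy
    simp only [collapse] at hw
    split_ifs at hw <;> omega
  rcases hcases with ⟨rfl, ⟨rfl, rfl⟩ | ⟨rfl, rfl⟩⟩ | ⟨rfl, ⟨rfl, rfl⟩ | ⟨rfl, rfl⟩⟩ |
    ⟨rfl, rfl, rfl⟩ | ⟨rfl, rfl, rfl⟩
  · exact ⟨a, x, y, ⟨hab, hxy, Gab, Gxy, Gcd⟩, by simp, by simp, by simp⟩
  · exact ⟨a, x, y, ⟨hcd, hxy, Gcd, Gxy, Gab⟩, by simp, by simp, by simp⟩
  · exact ⟨x, y, b, ⟨hxy, hcd, Gxy, Gcd, Gab⟩, by simp, by simp, by simp⟩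
  · exact ⟨x, y, b, ⟨hxy, hab, Gxy, Gab, Gcd⟩, by simp, by simp, by simp⟩
  · exact ⟨x, b, y, ⟨hab, hcd, Gab, Gcd, Gxy⟩, by simp, by simp, by simp⟩
  · exact ⟨x, a, y, ⟨hcd, hab, Gcd, Gab, Gxy⟩, by simp, by simp, by simp⟩

end Graph

/-! ### Jacobian ideals of products of edge forms -/

section Jacobian

variable {k : Type*} [Field k] {n : ℕ}

theorem pderiv_mem_jacobianIdeal (F : MvPolynomial (Fin n) k) (v : Fin n) :
    pderiv v F ∈ jacobianIdeal F :=
  Ideal.subset_span ⟨v, rfl⟩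

theorem jacobianIdeal_le {F : MvPolynomial (Fin n) k} {I : Ideal (MvPolynomial (Fin n) k)}
    (h : ∀ v, pderiv v F ∈ I) : jacobianIdeal F ≤ I := by
  rw [jacobianIdeal, Ideal.span_le]
  rintro _ ⟨v, rfl⟩
  exact h v

theorem pderiv_edgeForm_left {e : Fin n × Fin n} (he : e.1 ≠ e.2) :
    pderiv e.1 (edgeForm k e) = 1 := by
  rw [edgeForm, map_sub, pderiv_X_self, pderiv_X_of_ne he.symm, sub_zero]

theorem pderiv_edgeForm_right {e : Fin n × Fin n} (he : e.1 ≠ e.2) :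
    pderiv e.2 (edgeForm k e) = -1 := by
  rw [edgeForm, map_sub, pderiv_X_self, pderiv_X_of_ne he, zero_sub]

theorem pderiv_edgeForm_of_ne {e : Fin n × Fin n} {v : Fin n} (h1 : e.1 ≠ v) (h2 : e.2 ≠ v) :
    pderiv v (edgeForm k e) = 0 := by
  rw [edgeForm, map_sub, pderiv_X_of_ne h1, pderiv_X_of_ne h2, sub_zero]

/-- Distinct edges cannot share both ends, so `e` has an end outside `e'`; the sign `u` records
which end it is. -/
theorem exists_pderiv_edgeForm {e e' : Fin n × Fin n} (he : e.1 < e.2) (he' : e'.1 < e'.2)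
    (hne : e ≠ e') : ∃ (v : Fin n) (u : MvPolynomial (Fin n) k), u * u = 1 ∧
      pderiv v (edgeForm k e) = u ∧ pderiv v (edgeForm k e') = 0 := by
  by_cases h : e'.1 ≠ e.1 ∧ e'.2 ≠ e.1
  · exact ⟨e.1, 1, by ring, pderiv_edgeForm_left he.ne, pderiv_edgeForm_of_ne h.1 h.2⟩
  · refine ⟨e.2, -1, by ring, pderiv_edgeForm_right he.ne, pderiv_edgeForm_of_ne ?_ ?_⟩
    · intro h1
      rcases not_and_or.mp h with h2 | h2
      · exact he.ne ((not_not.mp h2).symm.trans h1)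
      · rw [← h1, ← not_not.mp h2] at he
        exact he.asymm he'
    · intro h1
      rcases not_and_or.mp h with h2 | h2
      · exact hne (Prod.ext (not_not.mp h2).symm h1.symm)
      · exact he.ne ((not_not.mp h2).symm.trans h1)

theorem pderiv_prod_mem_liaisonSum {ι : Type*} [DecidableEq ι] (s : Finset ι)
    (f : ι → MvPolynomial (Fin n) k) (I : ι → Ideal (MvPolynomial (Fin n) k)) (v : Fin n)
    (h : ∀ i ∈ s, pderiv v (f i) ∈ I i) :
    pderiv v (∏ i ∈ s, f i) ∈ liaisonSum f I s := by
  induction s using Finset.induction_on with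
  | empty => simp
  | insert i s hi ih =>
    rw [Finset.prod_insert hi, liaisonSum_insert hi, pderiv_mul,
      mul_comm (pderiv v (f i))]
    exact Submodule.add_mem_sup
      (Ideal.mul_mem_mul (Ideal.mem_span_singleton_self _) (h i (by simp)))
      (Ideal.mul_mem_mul (Ideal.mem_span_singleton_self _) (ih fun j hj => h j (by simp [hj])))

theorem exists_mul_mem_jacobianIdeal {F l l' H u : MvPolynomial (Fin n) k}
    {P : Ideal (MvPolynomial (Fin n) k)} (hF : F = l * l' * H) (hl : l ∈ P)
    (hH : H ∉ P) {v : Fin n} (hu : u * u = 1) (h1 : pderiv v l = u) (h2 : pderiv v l' = 0) :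
    ∃ s ∉ P, s * l' ∈ jacobianIdeal F := by
  -- Here `∂_v F = l' (u H + l ∂_v H)`, and the second factor is `u H` modulo `P`.
  refine ⟨u * H + l * pderiv v H, fun h => hH ?_, ?_⟩
  · have : u * H ∈ P := (P.add_mem_iff_left (P.mul_mem_right _ hl)).mp h
    have := P.mul_mem_left u this
    rwa [← mul_assoc, hu, one_mul] at this
  · convert pderiv_mem_jacobianIdeal F v using 1
    rw [hF, pderiv_mul, pderiv_mul, h1, h2]
    ring

theorem exists_mul_mem_jacobianIdeal_triangle (h3 : IsUnit (3 : MvPolynomial (Fin n) k))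
    {F a b H : MvPolynomial (Fin n) k} {P : Ideal (MvPolynomial (Fin n) k)}
    (hF : F = a * b * (a + b) * H) (ha : a ∈ P) (hb : b ∈ P) (hP : P.IsPrime) (hH : H ∉ P)
    {i m : Fin n} (hia : pderiv i a = 1) (hib : pderiv i b = 0) (hma : pderiv m a = 0)
    (hmb : pderiv m b = -1) :
    ∃ s ∉ P, ∀ x ∈ Ideal.span {b * (2 * a + b), a * (a + 2 * b)}, s * x ∈ jacobianIdeal F := by
  set U := pderiv i H with hU
  set V := pderiv m H with hV
  have hi : pderiv i F = b * (2 * a + b) * H + a * b * (a + b) * U := by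
    rw [hF, pderiv_mul, pderiv_mul, pderiv_mul, map_add, hia, hib]
    ring
  have hm : pderiv m F = -(a * (a + 2 * b)) * H + a * b * (a + b) * V := by
    rw [hF, pderiv_mul, pderiv_mul, pderiv_mul, map_add, hma, hmb]
    ring
  -- Put `A = b(2a + b)` and `B = a(a + 2b)`. Since `3ab(a + b) = aA + bB`, three times `∂_i F` and
  -- `∂_m F` are combinations of `A` and `B`. The multiplier is the determinant of this `2 × 2`
  -- system, congruent to `-9 H²` modulo `P`; its adjugate gives the coefficients used below.
  refine ⟨(3 * H + a * U) * (-3 * H + b * V) - a * b * U * V, fun h => ?_, ?_⟩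
  · have h9 : 3 * 3 * (H * H) ∈ P := by
      have := P.sub_mem (P.add_mem (P.mul_mem_right (-3 * U * H) ha)
        (P.mul_mem_right (3 * H * V) hb)) h
      convert this using 1
      ring
    rcases hP.mem_or_mem h9 with h | h
    · exact hP.ne_top (Ideal.eq_top_of_isUnit_mem _ h (h3.mul h3))
    · exact hH ((hP.mem_or_mem h).elim id id)
  · intro x hx
    obtain ⟨y, z, rfl⟩ := Ideal.mem_span_pair.mp hx
    have := (jacobianIdeal F).add_mem
      ((jacobianIdeal F).mul_mem_left (3 * (y * (-3 * H + b * V) - z * (a * V)))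
        (pderiv_mem_jacobianIdeal F i))
      ((jacobianIdeal F).mul_mem_left (3 * (-y * (b * U) + z * (3 * H + a * U)))
        (pderiv_mem_jacobianIdeal F m))
    rw [hi, hm] at this
    convert this using 1
    ring

theorem jacobianIdeal_edgeForm {e : Fin n × Fin n} (he : e.1 ≠ e.2) :
    jacobianIdeal (edgeForm k e) = ⊤ := by
  rw [Ideal.eq_top_iff_one, ← pderiv_edgeForm_left (k := k) he]
  exact pderiv_mem_jacobianIdeal _ _

theorem jacobianIdeal_triangle {a b : MvPolynomial (Fin n) k} {i m : Fin n}
    (hia : pderiv i a = 1) (hib : pderiv i b = 0) (hma : pderiv m a = 0) (hmb : pderiv m b = -1) :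
    jacobianIdeal (a * b * (a + b)) = Ideal.span {b * (2 * a + b), a * (a + 2 * b)} := by
  have key : ∀ v, pderiv v (a * b * (a + b)) =
      pderiv v a * (b * (2 * a + b)) + pderiv v b * (a * (a + 2 * b)) := by
    intro v
    rw [pderiv_mul, pderiv_mul, map_add]
    ring
  apply le_antisymm
  · refine jacobianIdeal_le fun v => ?_
    rw [key]
    exact Ideal.mem_span_pair.mpr ⟨_, _, rfl⟩
  · rw [Ideal.span_le]
    rintro x (rfl | rfl)
    · have := pderiv_mem_jacobianIdeal (a * b * (a + b)) i
      rw [key, hia, hib] at this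
      simpa using this
    · have := pderiv_mem_jacobianIdeal (a * b * (a + b)) m
      rw [key, hma, hmb] at this
      simpa using this

theorem radical_span_triangle {R : Type*} [CommRing R] (h3 : IsUnit (3 : R)) {a b : R}
    (hP : (Ideal.span {a, b}).IsPrime) :
    (Ideal.span {b * (2 * a + b), a * (a + 2 * b)}).radical = Ideal.span {a, b} := by
  obtain ⟨c, hc⟩ := h3.exists_left_inv
  apply le_antisymm
  · rw [hP.radical_le_iff, Ideal.span_le]
    rintro x (rfl | rfl)
    · exact Ideal.mul_mem_right _ _ (Ideal.subset_span (by simp))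
    · exact Ideal.mul_mem_right _ _ (Ideal.subset_span (by simp))
  · rw [Ideal.span_le]
    rintro x (rfl | rfl)
    · refine ⟨3, Ideal.mem_span_pair.mpr ⟨-4 * c * x, x + 2 * c * b, ?_⟩⟩
      linear_combination -(2 * x ^ 2 * b) * hc
    · refine ⟨3, Ideal.mem_span_pair.mpr ⟨x + 2 * c * a, -4 * c * x, ?_⟩⟩
      linear_combination -(2 * a * x ^ 2) * hc

end Jacobian

/-! ### The graphic arrangement -/

section Graphic

variable (k : Type*) [Field k] {n : ℕ} (G : SimpleGraph (Fin n))

/-- The ideals of the flats of codimension two. -/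
def flatIdeals : Set (Ideal (MvPolynomial (Fin n) k)) :=
  {P | ∃ e ∈ orderedEdges G, ∃ e' ∈ orderedEdges G, e ≠ e' ∧
    P = Ideal.span {edgeForm k e, edgeForm k e'}}

/-- The product of the linear forms of a set of edges. -/
noncomputable def edgeProd (c : Finset (Fin n × Fin n)) : MvPolynomial (Fin n) k :=
  ∏ e ∈ c, edgeForm k e

variable {k G}

theorem graphicPolynomial_eq_prod :
    graphicPolynomial k G = ∏ e ∈ orderedEdges G, edgeForm k e := by
  simp only [graphicPolynomial, orderedEdges, edgeForm]

theorem prod_edgeProd (hG : G.EdgeDisjointTriangles) :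
    ∏ c ∈ edgeClasses G, edgeProd k c = graphicPolynomial k G := by
  rw [graphicPolynomial_eq_prod, ← prod_edgeClasses hG]
  rfl

theorem edgeProd_triangle {i j m : Fin n} (h : IsTriangle G i j m) :
    edgeProd k (triangleEdges i j m) =
      edgeForm k (i, j) * edgeForm k (j, m) * (edgeForm k (i, j) + edgeForm k (j, m)) := by
  have h1 := h.lt_left.ne
  have h2 := h.lt_right.ne
  rw [edgeProd, triangleEdges, Finset.prod_insert, Finset.prod_insert, Finset.prod_singleton]
  · simp only [edgeForm]
    ring
  · simp [h1.symm]
  · simp [h1, h2]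

theorem span_edgeForm_triangle {i j m : Fin n} {e e' : Fin n × Fin n}
    (he : e ∈ triangleEdges i j m) (he' : e' ∈ triangleEdges i j m) (hne : e ≠ e') :
    Ideal.span {edgeForm k e, edgeForm k e'} =
      Ideal.span {edgeForm k (i, j), edgeForm k (j, m)} := by
  have hs : edgeForm k (i, m) = edgeForm k (i, j) + edgeForm k (j, m) := by
    simp only [edgeForm]; ring
  rcases mem_triangleEdges.mp he with rfl | rfl | rfl <;>
    rcases mem_triangleEdges.mp he' with rfl | rfl | rfl <;>
    first
    | exact absurd rfl hne
    | rfl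
    | exact Ideal.span_pair_comm
    | skip
  · rw [hs, add_comm, Ideal.span_pair_add_left]
  · rw [hs, Ideal.span_pair_add_left, Ideal.span_pair_comm]
  · rw [hs, add_comm, Ideal.span_pair_add_right, Ideal.span_pair_comm]
  · rw [hs, Ideal.span_pair_add_right]

theorem IsTriangle.span_mem_flatIdeals {i j m : Fin n} (h : IsTriangle G i j m) :
    Ideal.span {edgeForm k (i, j), edgeForm k (j, m)} ∈ flatIdeals k G :=
  ⟨(i, j), h.subset (by simp [triangleEdges]), (j, m), h.subset (by simp [triangleEdges]),
    fun h' => h.lt_left.ne (congrArg Prod.fst h'), rfl⟩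

theorem IsTriangle.jacobianIdeal_edgeProd {i j m : Fin n} (h : IsTriangle G i j m) :
    jacobianIdeal (edgeProd k (triangleEdges i j m)) =
      Ideal.span {edgeForm k (j, m) * (2 * edgeForm k (i, j) + edgeForm k (j, m)),
        edgeForm k (i, j) * (edgeForm k (i, j) + 2 * edgeForm k (j, m))} := by
  rw [edgeProd_triangle h]
  exact jacobianIdeal_triangle (i := i) (m := m)
    (pderiv_edgeForm_left (e := (i, j)) h.lt_left.ne)
    (pderiv_edgeForm_of_ne h.lt_left.ne' (h.lt_left.trans h.lt_right).ne')
    (pderiv_edgeForm_of_ne (h.lt_left.trans h.lt_right).ne h.lt_right.ne)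
    (pderiv_edgeForm_right (e := (j, m)) h.lt_right.ne)

theorem jacobianIdeal_edgeProd_singleton {e : Fin n × Fin n} (he : e ∈ orderedEdges G) :
    jacobianIdeal (edgeProd k {e}) = ⊤ := by
  rw [edgeProd, Finset.prod_singleton]
  exact jacobianIdeal_edgeForm (mem_orderedEdges.mp he).1.ne

/-- Edges from different classes are distinct, so the class products are coprime in pairs, and two
of them generate an ideal assembled from the flats of pairs of edges. -/
theorem assembled_liaisonSum (hG : G.EdgeDisjointTriangles)
    (I : Finset (Fin n × Fin n) → Ideal (MvPolynomial (Fin n) k))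
    (hI : ∀ c ∈ edgeClasses G, edgeProd k c ∈ I c ∧ Assembled (flatIdeals k G) (I c)) :
    Assembled (flatIdeals k G) (liaisonSum (edgeProd k) I (edgeClasses G)) := by
  have hne : ∀ c ∈ edgeClasses G, ∀ c' ∈ edgeClasses G, c ≠ c' → ∀ e ∈ c, ∀ e' ∈ c',
      e ∈ orderedEdges G ∧ e' ∈ orderedEdges G ∧ e ≠ e' := by
    intro c hc c' hc' hcc e he e' he'
    obtain ⟨h1, h2⟩ := edgeClass_eq_of_mem hG hc he
    obtain ⟨h3, h4⟩ := edgeClass_eq_of_mem hG hc' he'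
    exact ⟨h1, h3, fun h => hcc (by rw [← h2, ← h4, h])⟩
  have hrel : ∀ c ∈ edgeClasses G, ∀ c' ∈ edgeClasses G, c ≠ c' → ∀ e ∈ c, ∀ e' ∈ c',
      IsRelPrime (edgeForm k e) (edgeForm k e') := by
    intro c hc c' hc' hcc e he e' he'
    obtain ⟨h1, h2, h3⟩ := hne c hc c' hc' hcc e he e' he'
    exact isRelPrime_edgeForm (mem_orderedEdges.mp h1).1 (mem_orderedEdges.mp h2).1 h3
  refine .liaisonSum (fun c hc => (hI c hc).1) (fun c hc => (hI c hc).2) ?_ ?_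
  · intro c hc c' hc' hcc
    exact IsRelPrime.prod_left fun e he => IsRelPrime.prod_right fun e' he' =>
      hrel c hc c' hc' hcc e he e' he'
  · intro c hc c' hc' hcc
    refine .span_prod_prod c c' _ _ (hrel c hc c' hc' hcc) fun e he e' he' => ?_
    obtain ⟨h1, h2, h3⟩ := hne c hc c' hc' hcc e he e' he'
    exact .of_mem ⟨e, h1, e', h2, h3, rfl⟩

/-- A flat belongs either to edges of different classes, or to a 3-cycle. -/
theorem flatIdeals_cases (hG : G.EdgeDisjointTriangles) {P : Ideal (MvPolynomial (Fin n) k)}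
    (hP : P ∈ flatIdeals k G) :
    (∃ e ∈ orderedEdges G, ∃ e' ∈ orderedEdges G, edgeClass G e ≠ edgeClass G e' ∧
      P = Ideal.span {edgeForm k e, edgeForm k e'}) ∨
    ∃ i j m, IsTriangle G i j m ∧ P = Ideal.span {edgeForm k (i, j), edgeForm k (j, m)} := by
  obtain ⟨e, he, e', he', hne, rfl⟩ := hP
  by_cases hc : edgeClass G e = edgeClass G e'
  · right
    have hmem := mem_edgeClass_self he'
    rw [← hc] at hmem
    rcases edgeClass_eq_singleton_or hG he with h | ⟨i, j, m, h, h1, h2⟩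
    · rw [h, Finset.mem_singleton] at hmem
      exact absurd hmem.symm hne
    · rw [h2] at hmem
      exact ⟨i, j, m, h, span_edgeForm_triangle h1 hmem hne⟩
  · exact Or.inl ⟨e, he, e', he', hc, rfl⟩

theorem jacobianIdeal_le_of_mem_flatIdeals {P : Ideal (MvPolynomial (Fin n) k)}
    (hP : P ∈ flatIdeals k G) : jacobianIdeal (graphicPolynomial k G) ≤ P := by
  obtain ⟨e, he, e', he', hne, rfl⟩ := hP
  refine jacobianIdeal_le fun v => ?_
  rw [graphicPolynomial_eq_prod, ← Finset.mul_prod_erase _ _ he,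
    ← Finset.mul_prod_erase _ _ (Finset.mem_erase.mpr ⟨hne.symm, he'⟩), pderiv_mul, pderiv_mul]
  have h1 : edgeForm k e ∈ Ideal.span {edgeForm k e, edgeForm k e'} :=
    Ideal.subset_span (by simp)
  have h2 : edgeForm k e' ∈ Ideal.span {edgeForm k e, edgeForm k e'} :=
    Ideal.subset_span (by simp)
  exact Ideal.add_mem _ (Ideal.mul_mem_left _ _ (Ideal.mul_mem_right _ _ h2))
    (Ideal.mul_mem_right _ _ h1)

theorem liaisonSum_le_of_edgeClass_ne (I : Finset (Fin n × Fin n) → Ideal (MvPolynomial (Fin n) k))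
    {e e' : Fin n × Fin n} (he : e ∈ orderedEdges G) (he' : e' ∈ orderedEdges G)
    (hc : edgeClass G e ≠ edgeClass G e') :
    liaisonSum (edgeProd k) I (edgeClasses G) ≤ Ideal.span {edgeForm k e, edgeForm k e'} := by
  refine liaisonSum_le_of_mem_of_mem (mem_edgeClasses.mpr ⟨e, he, rfl⟩)
    (mem_edgeClasses.mpr ⟨e', he', rfl⟩) hc ?_ ?_
  · exact Ideal.mem_of_dvd _ (Finset.dvd_prod_of_mem _ (mem_edgeClass_self he))
      (Ideal.subset_span (by simp))
  · exact Ideal.mem_of_dvd _ (Finset.dvd_prod_of_mem _ (mem_edgeClass_self he'))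
      (Ideal.subset_span (by simp))

theorem jacobianIdeal_le_liaisonSum (hG : G.EdgeDisjointTriangles) :
    jacobianIdeal (graphicPolynomial k G) ≤
      liaisonSum (edgeProd k) (fun c => jacobianIdeal (edgeProd k c)) (edgeClasses G) := by
  refine jacobianIdeal_le fun v => ?_
  rw [← prod_edgeProd hG]
  exact pderiv_prod_mem_liaisonSum _ _ _ _ fun c _ => pderiv_mem_jacobianIdeal _ _

/-! ### Local comparison at the flats and global consequences -/

variable [CharZero k]

theorem isUnit_three_mvPolynomial : IsUnit (3 : MvPolynomial (Fin n) k) := by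
  have : IsUnit (C (3 : k) : MvPolynomial (Fin n) k) := (isUnit_iff_ne_zero.mpr three_ne_zero).map C
  rwa [map_ofNat] at this

theorem isPrime_of_mem_flatIdeals {P : Ideal (MvPolynomial (Fin n) k)} (hP : P ∈ flatIdeals k G) :
    P.IsPrime := by
  obtain ⟨e, he, e', he', hne, rfl⟩ := hP
  exact isPrime_span_edgeForm_pair (mem_orderedEdges.mp he).1 (mem_orderedEdges.mp he').1 hne

theorem height_of_mem_flatIdeals {P : Ideal (MvPolynomial (Fin n) k)} (hP : P ∈ flatIdeals k G) :
    P.height = 2 := by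
  obtain ⟨e, he, e', he', hne, rfl⟩ := hP
  exact height_span_edgeForm_pair (mem_orderedEdges.mp he).1 (mem_orderedEdges.mp he').1 hne

theorem isCohenMacaulay_of_assembled {I : Ideal (MvPolynomial (Fin n) k)}
    (h : Assembled (flatIdeals k G) I) : IsCohenMacaulay (MvPolynomial (Fin n) k ⧸ I) := by
  obtain ⟨m, φ, hφ⟩ := exists_generic_coordinates k n
  let := φ.toRingHom.toAlgebra
  -- The same `φ` serves every flat, so all the quotients by flat primes are free of rank one over
  -- one polynomial ring.
  obtain ⟨_, _⟩ := h.finite_projective (A := MvPolynomial (Fin m) k) fun P hP => by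
    obtain ⟨e, he, e', he', hne, rfl⟩ := hP
    obtain ⟨ψ, h1, h2, h3⟩ := hφ e e' (mem_orderedEdges.mp he).1 (mem_orderedEdges.mp he').1 hne
    exact finite_projective_of_retraction ψ.toRingHom h1 h2 h3
  exact isCohenMacaulay_of_finite_flat k (Fin m) _

theorem assembled_jacobianIdeal_edgeProd (hG : G.EdgeDisjointTriangles)
    {c : Finset (Fin n × Fin n)} (hc : c ∈ edgeClasses G) :
    Assembled (flatIdeals k G) (jacobianIdeal (edgeProd k c)) := by
  rcases eq_singleton_or_of_mem_edgeClasses hG hc with ⟨e, he, rfl⟩ | ⟨i, j, m, h, rfl⟩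
  · rw [jacobianIdeal_edgeProd_singleton he]
    exact .top
  · rw [h.jacobianIdeal_edgeProd]
    exact .span_triangle isUnit_three_mvPolynomial
      (isRelPrime_edgeForm h.lt_left h.lt_right fun h' => h.lt_left.ne (congrArg Prod.fst h'))
      (.of_mem h.span_mem_flatIdeals)

theorem IsTriangle.radical_jacobianIdeal_edgeProd {i j m : Fin n} (h : IsTriangle G i j m) :
    (jacobianIdeal (edgeProd k (triangleEdges i j m))).radical =
      Ideal.span {edgeForm k (i, j), edgeForm k (j, m)} := by
  rw [h.jacobianIdeal_edgeProd]
  exact radical_span_triangle isUnit_three_mvPolynomial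
    (isPrime_of_mem_flatIdeals h.span_mem_flatIdeals)

theorem assembled_radical_jacobianIdeal_edgeProd (hG : G.EdgeDisjointTriangles)
    {c : Finset (Fin n × Fin n)} (hc : c ∈ edgeClasses G) :
    Assembled (flatIdeals k G) (jacobianIdeal (edgeProd k c)).radical := by
  rcases eq_singleton_or_of_mem_edgeClasses hG hc with ⟨e, he, rfl⟩ | ⟨i, j, m, h, rfl⟩
  · rw [jacobianIdeal_edgeProd_singleton he, Ideal.radical_top]
    exact .top
  · rw [h.radical_jacobianIdeal_edgeProd]
    exact .of_mem h.span_mem_flatIdeals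

theorem edgeProd_mem_jacobianIdeal (hG : G.EdgeDisjointTriangles)
    {c : Finset (Fin n × Fin n)} (hc : c ∈ edgeClasses G) :
    edgeProd k c ∈ jacobianIdeal (edgeProd k c) := by
  rcases eq_singleton_or_of_mem_edgeClasses hG hc with ⟨e, he, rfl⟩ | ⟨i, j, m, h, rfl⟩
  · rw [jacobianIdeal_edgeProd_singleton he]
    trivial
  · rw [h.jacobianIdeal_edgeProd, edgeProd_triangle h]
    obtain ⟨u, hu⟩ := (isUnit_three_mvPolynomial (k := k) (n := n)).exists_left_inv
    -- Euler's relation for a cubic, with `u = 1/3`.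
    refine Ideal.mem_span_pair.mpr ⟨u * edgeForm k (i, j), u * edgeForm k (j, m), ?_⟩
    linear_combination (edgeForm k (i, j) * edgeForm k (j, m) *
      (edgeForm k (i, j) + edgeForm k (j, m))) * hu

/-- At the flat of two edges from different classes the Jacobian ideal is the ideal of
the flat. -/
theorem exists_mul_mem_of_edgeClass_ne (hG : G.EdgeDisjointTriangles) {e e' : Fin n × Fin n}
    (he : e ∈ orderedEdges G) (he' : e' ∈ orderedEdges G) (hc : edgeClass G e ≠ edgeClass G e') :
    ∃ s ∉ Ideal.span {edgeForm k e, edgeForm k e'},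
      ∀ x ∈ Ideal.span {edgeForm k e, edgeForm k e'},
        s * x ∈ jacobianIdeal (graphicPolynomial k G) := by
  have hne : e ≠ e' := fun h => hc (by rw [h])
  have hlt := (mem_orderedEdges.mp he).1
  have hlt' := (mem_orderedEdges.mp he').1
  have hP := isPrime_span_edgeForm_pair (k := k) hlt hlt' hne
  set P := Ideal.span {edgeForm k e, edgeForm k e'} with hPdef
  set H := ∏ x ∈ ((orderedEdges G).erase e).erase e', edgeForm k x with hHdef
  have hF : graphicPolynomial k G = edgeForm k e * edgeForm k e' * H := by
    rw [graphicPolynomial_eq_prod, ← Finset.mul_prod_erase _ _ he,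
      ← Finset.mul_prod_erase _ _ (Finset.mem_erase.mpr ⟨hne.symm, he'⟩), mul_assoc]
  have hH : H ∉ P := by
    intro h
    obtain ⟨x, hx, hxP⟩ := hP.prod_mem_iff.mp h
    simp only [Finset.mem_erase] at hx
    rcases eq_or_eq_or_triangle_of_mem_span he he' hx.2.2 hne hxP with h | h |
      ⟨i, j, m, hT, h1, h2, -⟩
    · exact hx.2.1 h
    · exact hx.1 h
    · exact hc (by rw [hT.edgeClass_eq hG h1, hT.edgeClass_eq hG h2])
  obtain ⟨v, u, hu, hv1, hv2⟩ := exists_pderiv_edgeForm (k := k) hlt hlt' hne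
  obtain ⟨v', u', hu', hv1', hv2'⟩ := exists_pderiv_edgeForm (k := k) hlt' hlt hne.symm
  obtain ⟨s, hs, hsJ⟩ := exists_mul_mem_jacobianIdeal hF (P := P)
    (Ideal.subset_span (by simp)) hH hu hv1 hv2
  obtain ⟨s', hs', hsJ'⟩ := exists_mul_mem_jacobianIdeal (hF.trans (by ring :
      _ = edgeForm k e' * edgeForm k e * H)) (P := P)
    (Ideal.subset_span (by simp)) hH hu' hv1' hv2'
  refine ⟨s * s', fun h => (hP.mem_or_mem h).elim hs hs', fun x hx => ?_⟩
  obtain ⟨y, z, rfl⟩ := Ideal.mem_span_pair.mp hx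
  convert Ideal.add_mem _ (Ideal.mul_mem_left _ (s * y) hsJ') (Ideal.mul_mem_left _ (s' * z) hsJ)
    using 1
  ring

/-- An edge form vanishing on the flat of a triangle belongs to that triangle, so the product of the
other classes is a unit locally at the flat. -/
theorem IsTriangle.prod_erase_notMem (hG : G.EdgeDisjointTriangles) {i j m : Fin n}
    (h : IsTriangle G i j m) : ∏ c ∈ (edgeClasses G).erase (triangleEdges i j m), edgeProd k c ∉
      Ideal.span {edgeForm k (i, j), edgeForm k (j, m)} := by
  have hP := isPrime_of_mem_flatIdeals (h.span_mem_flatIdeals (k := k))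
  have h1 : (i, j) ∈ triangleEdges i j m := by simp [triangleEdges]
  have h2 : (j, m) ∈ triangleEdges i j m := by simp [triangleEdges]
  intro hmem
  obtain ⟨c, hc, hcP⟩ := hP.prod_mem_iff.mp hmem
  obtain ⟨e, he, heP⟩ := hP.prod_mem_iff.mp hcP
  obtain ⟨hne, hc⟩ := Finset.mem_erase.mp hc
  obtain ⟨he1, he2⟩ := edgeClass_eq_of_mem hG hc he
  refine hne ?_
  rw [← he2]
  refine h.edgeClass_eq hG ?_
  rcases eq_or_eq_or_triangle_of_mem_span (h.subset h1) (h.subset h2) he1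
    (fun h' => h.lt_left.ne (congrArg Prod.fst h')) heP with rfl | rfl | ⟨i', j', m', hT, h3, -, h4⟩
  · exact h1
  · exact h2
  · obtain ⟨rfl, rfl, rfl⟩ := h.unique hG hT h1 h3
    exact h4

theorem IsTriangle.mem_edgeClasses (hG : G.EdgeDisjointTriangles) {i j m : Fin n}
    (h : IsTriangle G i j m) : triangleEdges i j m ∈ edgeClasses G :=
  GraphicCM.mem_edgeClasses.mpr ⟨(i, j), h.subset (by simp [triangleEdges]),
    h.edgeClass_eq hG (by simp [triangleEdges])⟩

theorem IsTriangle.exists_mul_mem (hG : G.EdgeDisjointTriangles) {i j m : Fin n}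
    (h : IsTriangle G i j m) :
    ∃ s ∉ Ideal.span {edgeForm k (i, j), edgeForm k (j, m)},
      ∀ x ∈ jacobianIdeal (edgeProd k (triangleEdges i j m)),
        s * x ∈ jacobianIdeal (graphicPolynomial k G) := by
  rw [h.jacobianIdeal_edgeProd]
  refine exists_mul_mem_jacobianIdeal_triangle (i := i) (m := m) isUnit_three_mvPolynomial ?_
    (Ideal.subset_span (by simp)) (Ideal.subset_span (by simp))
    (isPrime_of_mem_flatIdeals h.span_mem_flatIdeals) (h.prod_erase_notMem hG)
    (pderiv_edgeForm_left (e := (i, j)) h.lt_left.ne)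
    (pderiv_edgeForm_of_ne h.lt_left.ne' (h.lt_left.trans h.lt_right).ne')
    (pderiv_edgeForm_of_ne (h.lt_left.trans h.lt_right).ne h.lt_right.ne)
    (pderiv_edgeForm_right (e := (j, m)) h.lt_right.ne)
  rw [← prod_edgeProd hG, ← Finset.mul_prod_erase _ _ (h.mem_edgeClasses hG), edgeProd_triangle h]

/-- Euler's formula puts `F` in `Q`, as its degree is invertible; so `Q` contains some edge form
`l`. As `∂F` is `F / l` modulo `l` for a suitable variable, `Q` also contains a second one. -/
theorem exists_flatIdeal_le (hE : (orderedEdges G).Nonempty) {Q : Ideal (MvPolynomial (Fin n) k)}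
    (hQ : Q.IsPrime) (hJ : jacobianIdeal (graphicPolynomial k G) ≤ Q) :
    ∃ P ∈ flatIdeals k G, P ≤ Q := by
  have hd : ∀ v, pderiv v (graphicPolynomial k G) ∈ Q := fun v =>
    hJ (pderiv_mem_jacobianIdeal _ v)
  have hhom : (graphicPolynomial k G).IsHomogeneous (∑ _e ∈ orderedEdges G, 1) := by
    rw [graphicPolynomial_eq_prod]
    exact IsHomogeneous.prod _ _ _ fun e _ => (isHomogeneous_X _ _).sub (isHomogeneous_X _ _)
  have hF : graphicPolynomial k G ∈ Q := by
    have h1 : (∑ _e ∈ orderedEdges G, 1) • graphicPolynomial k G ∈ Q := by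
      rw [← hhom.sum_X_mul_pderiv]
      exact Q.sum_mem fun v _ => Q.mul_mem_left _ (hd v)
    have h2 : IsUnit (((∑ _e ∈ orderedEdges G, 1 : ℕ) : MvPolynomial (Fin n) k)) := by
      have : ((∑ _e ∈ orderedEdges G, 1 : ℕ) : k) ≠ 0 := by
        rw [Nat.cast_ne_zero, Finset.sum_const, smul_eq_mul, mul_one]
        exact hE.card_pos.ne'
      simpa using (isUnit_iff_ne_zero.mpr this).map (C : k →+* MvPolynomial (Fin n) k)
    rw [nsmul_eq_mul] at h1
    exact (Ideal.unit_mul_mem_iff_mem Q h2).mp h1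
  rw [graphicPolynomial_eq_prod] at hF hd
  obtain ⟨e, he, heQ⟩ := hQ.prod_mem_iff.mp hF
  have h1 := hd e.1
  rw [← Finset.mul_prod_erase _ _ he, pderiv_mul,
    pderiv_edgeForm_left (mem_orderedEdges.mp he).1.ne, one_mul,
    Q.add_mem_iff_left (Q.mul_mem_right _ heQ)] at h1
  obtain ⟨e', he', heQ'⟩ := hQ.prod_mem_iff.mp h1
  obtain ⟨hne, he'⟩ := Finset.mem_erase.mp he'
  refine ⟨_, ⟨e, he, e', he', hne.symm, rfl⟩, Ideal.span_le.mpr ?_⟩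
  rintro x (rfl | rfl)
  · exact heQ
  · exact heQ'

theorem heightTwoPart_jacobianIdeal_eq (hG : G.EdgeDisjointTriangles)
    (hE : (orderedEdges G).Nonempty) {K : Ideal (MvPolynomial (Fin n) k)}
    (hK : IsHeightTwoPart (jacobianIdeal (graphicPolynomial k G)) K) :
    K = liaisonSum (edgeProd k) (fun c => jacobianIdeal (edgeProd k c)) (edgeClasses G) := by
  refine heightTwoPart_eq_of_assembled (fun P => isPrime_of_mem_flatIdeals)
    (fun P => height_of_mem_flatIdeals) (fun Q => exists_flatIdeal_le hE)
    (assembled_liaisonSum hG _ fun c hc =>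
      ⟨edgeProd_mem_jacobianIdeal hG hc, assembled_jacobianIdeal_edgeProd hG hc⟩)
    (jacobianIdeal_le_liaisonSum hG) (fun P hP => ?_) hK
  rcases flatIdeals_cases hG hP with ⟨e, he, e', he', hc, rfl⟩ | ⟨i, j, m, h, rfl⟩
  · obtain ⟨s, hs, hsx⟩ := exists_mul_mem_of_edgeClass_ne (k := k) hG he he' hc
    exact ⟨s, hs, fun x hx => hsx x (liaisonSum_le_of_edgeClass_ne _ he he' hc hx)⟩
  · obtain ⟨s, hs, hsx⟩ := h.exists_mul_mem (k := k) hG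
    exact ⟨s, hs, fun x hx => hsx x (liaisonSum_le_of_mem (h.mem_edgeClasses hG)
      (edgeProd_mem_jacobianIdeal hG (h.mem_edgeClasses hG)) hx)⟩

theorem radical_jacobianIdeal_eq (hG : G.EdgeDisjointTriangles)
    (hE : (orderedEdges G).Nonempty) :
    (jacobianIdeal (graphicPolynomial k G)).radical =
      liaisonSum (edgeProd k) (fun c => (jacobianIdeal (edgeProd k c)).radical)
        (edgeClasses G) := by
  refine radical_eq_of_assembled (fun P => isPrime_of_mem_flatIdeals)
    (fun P => jacobianIdeal_le_of_mem_flatIdeals) (fun Q => exists_flatIdeal_le hE)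
    (assembled_liaisonSum hG _ fun c hc =>
      ⟨Ideal.le_radical (edgeProd_mem_jacobianIdeal hG hc),
        assembled_radical_jacobianIdeal_edgeProd hG hc⟩) (fun P hP => ?_) (fun P hP => ?_)
  · rcases flatIdeals_cases hG hP with ⟨e, he, e', he', hc, rfl⟩ | ⟨i, j, m, h, rfl⟩
    · exact liaisonSum_le_of_edgeClass_ne _ he he' hc
    · rw [← h.radical_jacobianIdeal_edgeProd]
      exact liaisonSum_le_of_mem (h.mem_edgeClasses hG)
        (Ideal.le_radical (edgeProd_mem_jacobianIdeal hG (h.mem_edgeClasses hG)))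
  · rcases flatIdeals_cases hG hP with ⟨e, he, e', he', hc, rfl⟩ | ⟨i, j, m, h, rfl⟩
    · obtain ⟨s, hs, hsx⟩ := exists_mul_mem_of_edgeClass_ne (k := k) hG he he' hc
      refine ⟨s, hs, fun x hx => ?_⟩
      have hle : liaisonSum (edgeProd k) (fun c => jacobianIdeal (edgeProd k c)) (edgeClasses G) ≤
          liaisonSum (edgeProd k) (fun c => (jacobianIdeal (edgeProd k c)).radical)
            (edgeClasses G) :=
        liaisonSum_le prod_mem_liaisonSum fun c hc y hy =>
          mul_mem_liaisonSum hc (Ideal.le_radical hy)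
      exact hle (jacobianIdeal_le_liaisonSum hG (hsx x hx))
    · refine ⟨_, h.prod_erase_notMem hG, fun x hx => ?_⟩
      rw [← h.radical_jacobianIdeal_edgeProd] at hx
      exact mul_mem_liaisonSum (I := fun c => (jacobianIdeal (edgeProd k c)).radical)
        (h.mem_edgeClasses hG) hx

end Graphic

/-! ### Graphs without edges -/

/-- The zero ideal is prime, so it is itself a component, and minimality excludes all others; its
height is zero, so the intersection is empty. -/
theorem eq_top_of_isHeightTwoPart_bot {R : Type*} [CommRing R] [IsDomain R] {K : Ideal R}
    (hK : IsHeightTwoPart ⊥ K) : K = ⊤ := by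
  obtain ⟨t, ht, rfl⟩ := hK
  have hprime : (⊥ : Ideal R).IsPrime := Ideal.isPrime_bot
  obtain ⟨q₀, hq₀, hle⟩ := (hprime.inf_le' (s := t) (f := id)).mp ht.inf_eq.le
  have hbot : q₀ = ⊥ := le_bot_iff.mp hle
  rw [iInf₂_eq_top]
  rintro q ⟨hqt, hq⟩
  exfalso
  have hqq : q = q₀ := by
    by_contra hne
    refine ht.minimal hqt ?_
    refine (Finset.inf_le (Finset.mem_erase.mpr ⟨Ne.symm hne, hq₀⟩)).trans ?_
    rw [id, hbot]
    exact bot_le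
  rw [hqq, hbot, hprime.radical, Ideal.height_bot] at hq
  norm_num at hq

theorem isCohenMacaulay_quotient_top (R : Type*) [CommRing R] [IsNoetherianRing R] :
    IsCohenMacaulay (R ⧸ (⊤ : Ideal R)) := by
  refine LocallyFullRegularSequence.isCohenMacaulay fun p hp => absurd ?_ hp.ne_top
  have : Subsingleton (R ⧸ (⊤ : Ideal R)) := Ideal.Quotient.subsingleton_iff.mpr rfl
  exact Subsingleton.elim _ _

theorem isCohenMacaulay_mvPolynomial_quotient_bot (k : Type*) [Field k] (n : ℕ) :
    IsCohenMacaulay (MvPolynomial (Fin n) k ⧸ (⊥ : Ideal (MvPolynomial (Fin n) k))) :=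
  ((LocallyFullRegularSequence.mvPolynomial k (Fin n)).of_ringEquiv
    (RingEquiv.quotientBot _).symm).isCohenMacaulay

theorem jacobianIdeal_one (k : Type*) [Field k] (n : ℕ) :
    jacobianIdeal (1 : MvPolynomial (Fin n) k) = ⊥ :=
  le_bot_iff.mp (jacobianIdeal_le fun v => by simp)

end GraphicCM

theorem corollary5p1 (k : Type*) [Field k] [CharZero k] (n : ℕ) (G : SimpleGraph (Fin n))
    (hG : G.EdgeDisjointTriangles) :
    GraphicCM.IsCohenMacaulay (MvPolynomial (Fin n) k ⧸
        (GraphicCM.jacobianIdeal (GraphicCM.graphicPolynomial k G)).radical) ∧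
      ∀ K : Ideal (MvPolynomial (Fin n) k),
        GraphicCM.IsHeightTwoPart
            (GraphicCM.jacobianIdeal (GraphicCM.graphicPolynomial k G)) K →
          GraphicCM.IsCohenMacaulay (MvPolynomial (Fin n) k ⧸ K) := by
  open GraphicCM in
  rcases (orderedEdges G).eq_empty_or_nonempty with hE | hE
  -- Without edges `F = 1` and `J = 0`: the radical is zero and the height two part is the whole
  -- ring. The flats play no role here, since Euler's formula has degree zero.
  · rw [graphicPolynomial_eq_prod, hE, Finset.prod_empty, jacobianIdeal_one]
    refine ⟨?_, fun K hK => ?_⟩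
    · rw [(Ideal.isPrime_bot (α := MvPolynomial (Fin n) k)).radical]
      exact isCohenMacaulay_mvPolynomial_quotient_bot k n
    · rw [eq_top_of_isHeightTwoPart_bot hK]
      exact isCohenMacaulay_quotient_top _
  · refine ⟨?_, fun K hK => ?_⟩
    · rw [radical_jacobianIdeal_eq hG hE]
      exact isCohenMacaulay_of_assembled (assembled_liaisonSum hG _ fun c hc =>
        ⟨Ideal.le_radical (edgeProd_mem_jacobianIdeal hG hc),
          assembled_radical_jacobianIdeal_edgeProd hG hc⟩)
    · rw [heightTwoPart_jacobianIdeal_eq hG hE hK]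
      exact isCohenMacaulay_of_assembled (assembled_liaisonSum hG _ fun c hc =>
        ⟨edgeProd_mem_jacobianIdeal hG hc, assembled_jacobianIdeal_edgeProd hG hc⟩)
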